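/- Theorem. Let $\varepsilon\in\mathbb R$ with $|\varepsilon|<1$, let $\mathbb S^2\subset\mathbb R^3$ be the unit sphere with its round metric $g$, with spherical coordinates $(\phi,\theta)\mapsto(\sin\phi\cos\theta,\sin\phi\sin\theta,\cos\phi)$, $0<\phi<\pi$, and let $V=\partial/\partial\theta$ be the Killing field generating the rotations about the third axis. Let $F_\varepsilon$ be the Katok--Ziller metric associated with $\sqrt g$ and $V$, i.e. $F_\varepsilon=H_\varepsilon\circ\mathcal L_\varepsilon^{-1}$, where $H_\varepsilon(\eta)=\|\eta\|_{g^*}+\varepsilon\,\eta(V)$ on $T^*\mathbb S^2$ and $\mathcal L_\varepsilon\colon T^*\mathbb S^2\to T\mathbb S^2$ is the Legendre transform of $\tfrac12H_\varepsilon^2$; in the coordinates, $$F_\varepsilon(\phi,\theta;\xi_\phi,\xi_\theta)=\frac{\sqrt{(1-\varepsilon^2\sin^2\phi)\,\xi_\phi^2+\sin^2\phi\,\xi_\theta^2}-\varepsilon\sin^2\phi\,\xi_\theta}{1-\varepsilon^2\sin^2\phi}.$$ For a Finsler surface $(M,F)$ let $\pi\colon HM=(TM\smallsetminus 0)/\mathbb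 R_{>0}\to M$ be the homogenized bundle, $A$ the Hilbert form on $HM$ (whose pull-back to $TM\smallsetminus 0$ is $\frac{\partial F}{\partial v^i}dx^i$), $X$ its Reeb field ($A(X)=1$, $i_XdA=0$), which generates the geodesic flow, and $\alpha$ the angle form, determined on vertical vectors by $\alpha\wedge\pi^*\Omega=A\wedge dA$ and $\int_{H_xM}\alpha=2\pi$ for a volume form $\Omega$ on $M$. The Finsler--Laplace operator is $$\Delta^Ff(x)=\frac1\pi\int_{H_xM}L_X^2(\pi^*f)\,\alpha .$$ Then for every point with $0<\phi<\pi$ and every real- or complex-valued function $f$ on $\mathbb S^2$ of class $C^2$ near that point, the integral defining $\Delta^{F_\varepsilon}f$ there exists and $$\Delta^{F_\varepsilon}f=\frac{2}{1+\sqrt{1-\varepsilon^2\sin^2\phi}}\Biggl[\frac{(1-\varepsilon^2\sin^2\phi)^{3/2}}{\sin^2\phi}\,\frac{\partial^2f}{\partial\theta^2}+(1-\varepsilon^2\sin^2\phi)\,\frac{\partial^2f}{\partial\phi^2}+\frac{\cos\phi}{\sin\phi}\Bigl(\varepsilon^2\sin^2\phi+\sqrt{1-\varepsilon^2\sin^2\phi}\Bigr)\frac{\partial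 f}{\partial\phi}\Biggr].$$ -/

import Mathlib

open Real Set MeasureTheory Manifold
open scoped ContDiff

noncomputable section

namespace FinslerSurface

/-- The model plane of surfaces. -/
abbrev Plane : Type := EuclideanSpace ℝ (Fin 2)

/-! ## The homogenized bundle of a plane domain

Over a domain `U` of the plane, a point of `HU = (TU ∖ 0) / ℝ₊` is a pair of a base point `x` and a
ray of `ℝ²`.  It is given the coordinates `(x, t)`, where the ray is `ℝ₊ · (cos t, sin t)` and `t` is
taken modulo `2π`.  All objects on `HU` below are written in these coordinates, hence as
`2π`-periodic objects on `U × ℝ`. -/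

/-- The coordinate space of the homogenized bundle of a plane domain. -/
abbrev HPlane : Type := Plane × ℝ

/-- The vector `(cos t, sin t)`, a representative of the ray with angular coordinate `t`. -/
def ray (t : ℝ) : Plane := !₂[Real.cos t, Real.sin t]

/-- The vertical coordinate vector `∂/∂t`, which spans the vertical bundle `VHU`. -/
def vert : HPlane := (0, 1)

/-- The coordinate vectors `∂/∂x¹`, `∂/∂x²` on the homogenized bundle. -/
def horiz (i : Fin 2) : HPlane := (EuclideanSpace.single i 1, 0)

/-- The Hilbert form `A` of `F`: its pull-back to `TU ∖ 0` is the vertical derivative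
`d_v F = (∂F/∂vⁱ) dxⁱ`, which is homogeneous of degree `0` in `v`. -/
def hilbertForm (F : Plane → Plane → ℝ) (z : HPlane) : HPlane [⋀^Fin 1]→L[ℝ] ℝ :=
  ContinuousAlternatingMap.ofSubsingleton ℝ HPlane ℝ 0
    ((fderiv ℝ (F z.1) (ray z.2)).comp (ContinuousLinearMap.fst ℝ Plane ℝ))

/-- The exterior derivative `dA` of the Hilbert form. -/
def dHilbertForm (F : Plane → Plane → ℝ) (z : HPlane) : HPlane [⋀^Fin 2]→L[ℝ] ℝ :=
  extDeriv (hilbertForm F) z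

/-- The exterior product `a ∧ b` of a `1`-form and a `2`-form, evaluated on `(u, v, w)`. -/
def wedge {E : Type*} [NormedAddCommGroup E] [NormedSpace ℝ E]
    (a : E [⋀^Fin 1]→L[ℝ] ℝ) (b : E [⋀^Fin 2]→L[ℝ] ℝ) (u v w : E) : ℝ :=
  a ![u] * b ![v, w] - a ![v] * b ![u, w] + a ![w] * b ![u, v]

/-- `X` is the value at `z` of the Reeb field of the Hilbert form: `A(X) = 1` and `i_X dA = 0`. -/
def IsReebAt (F : Plane → Plane → ℝ) (z X : HPlane) : Prop :=
  hilbertForm F z ![X] = 1 ∧ ∀ w : HPlane, dHilbertForm F z ![X, w] = 0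

/-- The Reeb field `X` of the Hilbert form, i.e. the generator of the geodesic flow of `F`.  (When
`F` is a Finsler metric, `A` is a contact form and `X` is the unique field with this property.) -/
def geodesicField (F : Plane → Plane → ℝ) (z : HPlane) : HPlane :=
  Classical.epsilon (IsReebAt F z)

/-- The Lie derivative along the geodesic field of a function on the homogenized bundle. -/
def lieDeriv {𝕜 : Type*} [RCLike 𝕜] (F : Plane → Plane → ℝ) (g : HPlane → 𝕜) (z : HPlane) : 𝕜 :=
  fderiv ℝ g z (geodesicField F z)

/-- The value of `A ∧ dA` on `(∂/∂t, ∂/∂x¹, ∂/∂x²)`. -/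
def liouvilleDensity (F : Plane → Plane → ℝ) (z : HPlane) : ℝ :=
  wedge (hilbertForm F z) (dHilbertForm F z) vert (horiz 0) (horiz 1)

/-- The coefficient of `dx¹ ∧ dx²` in the volume form `Ω` of `F`.  With `ω = dx¹ ∧ dx²` and
`α^ω ∧ π^*ω = A ∧ dA`, this is `(1 / 2π) ∫_{H_x} α^ω`. -/
def volumeDensity (F : Plane → Plane → ℝ) (x : Plane) : ℝ :=
  (∫ t in (0 : ℝ)..(2 * π), liouvilleDensity F (x, t)) / (2 * π)

/-- The determinant `dx¹ ∧ dx²` of the plane. -/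
def planeDet : Plane [⋀^Fin 2]→L[ℝ] ℝ :=
  { toFun := fun v => v 0 0 * v 1 1 - v 0 1 * v 1 0
    map_update_add' := by
      intro _ m i x y
      fin_cases i <;> simp [Function.update] <;> ring
    map_update_smul' := by
      intro _ m i c x
      fin_cases i <;> simp [Function.update] <;> ring
    map_eq_zero_of_eq' := by
      intro v i j h hij
      fin_cases i <;> fin_cases j <;> simp_all <;> ring
    cont := by fun_prop }

theorem planeDet_apply (v : Fin 2 → Plane) :
    planeDet v = v 0 0 * v 1 1 - v 0 1 * v 1 0 := rfl

/-- The canonical volume form `Ω` of `F` on the base. -/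
def volumeForm (F : Plane → Plane → ℝ) (x : Plane) : Plane [⋀^Fin 2]→L[ℝ] ℝ :=
  volumeDensity F x • planeDet

/-- The angle form `α` of `F`, with its representative that is a multiple of `dt`.  It is
determined on the vertical bundle by `α ∧ π^*Ω = A ∧ dA` and `∫_{H_x} α = 2π`; see
`angleForm_wedge_volumeForm` and `integral_angleForm`. -/
def angleForm (F : Plane → Plane → ℝ) (z : HPlane) : HPlane [⋀^Fin 1]→L[ℝ] ℝ :=
  ContinuousAlternatingMap.ofSubsingleton ℝ HPlane ℝ 0
    ((liouvilleDensity F z / volumeDensity F z.1) • ContinuousLinearMap.snd ℝ Plane ℝ)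

theorem angleForm_vert (F : Plane → Plane → ℝ) (z : HPlane) :
    angleForm F z ![vert] = liouvilleDensity F z / volumeDensity F z.1 := by
  simp [angleForm, vert]

theorem integral_angleForm (F : Plane → Plane → ℝ) (x : Plane) (h : volumeDensity F x ≠ 0) :
    ∫ t in (0 : ℝ)..(2 * π), angleForm F (x, t) ![vert] = 2 * π := by
  have hpi : (2 * π : ℝ) ≠ 0 := by positivity
  simp only [angleForm_vert, intervalIntegral.integral_div]
  rw [div_eq_iff h, volumeDensity]
  field_simp

theorem twoForm_swap (b : HPlane [⋀^Fin 2]→L[ℝ] ℝ) (u v : HPlane) : b ![u, v] = -b ![v, u] := by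
  have h := b.toAlternatingMap.map_swap ![v, u] (i := 0) (j := 1) (by decide)
  have e : (![v, u] ∘ Equiv.swap (0 : Fin 2) 1) = ![u, v] := by
    ext i <;> fin_cases i <;> simp
  rw [e] at h
  exact h

theorem twoForm_self (b : HPlane [⋀^Fin 2]→L[ℝ] ℝ) (u : HPlane) : b ![u, u] = 0 := by
  linarith [twoForm_swap b u u]

theorem twoForm_comb (b : HPlane [⋀^Fin 2]→L[ℝ] ℝ) (c₀ c₁ c₂ : ℝ) (x₀ x₁ x₂ v : HPlane) :
    b ![c₀ • x₀ + c₁ • x₁ + c₂ • x₂, v] =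
      c₀ * b ![x₀, v] + c₁ * b ![x₁, v] + c₂ * b ![x₂, v] := by
  have ha : ∀ x y : HPlane, b ![x + y, v] = b ![x, v] + b ![y, v] := fun x y =>
    b.toAlternatingMap.toMultilinearMap.cons_add ![v] x y
  have hs : ∀ (c : ℝ) (x : HPlane), b ![c • x, v] = c * b ![x, v] := fun c x =>
    b.toAlternatingMap.toMultilinearMap.cons_smul ![v] c x
  rw [ha, ha, hs, hs, hs]

theorem hplane_eq (u : HPlane) :
    u = u.1 0 • horiz 0 + u.1 1 • horiz 1 + u.2 • vert := by
  ext i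
  · fin_cases i <;> simp [horiz, vert]
  · simp [horiz, vert]

theorem twoForm_eq (b : HPlane [⋀^Fin 2]→L[ℝ] ℝ) (u v : HPlane) :
    b ![u, v] = (u.1 0 * v.1 1 - u.1 1 * v.1 0) * b ![horiz 0, horiz 1]
      + (u.2 * v.1 0 - u.1 0 * v.2) * b ![vert, horiz 0]
      + (u.2 * v.1 1 - u.1 1 * v.2) * b ![vert, horiz 1] := by
  have key : ∀ x : HPlane, b ![x, v] =
      -(v.1 0 * b ![horiz 0, x] + v.1 1 * b ![horiz 1, x] + v.2 * b ![vert, x]) := by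
    intro x
    rw [twoForm_swap]
    conv_lhs => rw [hplane_eq v, twoForm_comb]
  conv_lhs => rw [hplane_eq u, twoForm_comb, key, key, key]
  rw [twoForm_self, twoForm_self, twoForm_self, twoForm_swap b (horiz 1) (horiz 0),
    twoForm_swap b (horiz 0) vert, twoForm_swap b (horiz 1) vert]
  ring

/-- `α ∧ π^*Ω = A ∧ dA`. -/
theorem angleForm_wedge_volumeForm (F : Plane → Plane → ℝ) (z : HPlane)
    (h : volumeDensity F z.1 ≠ 0) (u v w : HPlane) :
    wedge (angleForm F z)
        ((volumeForm F z.1).compContinuousLinearMap (ContinuousLinearMap.fst ℝ Plane ℝ)) u v w =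
      wedge (hilbertForm F z) (dHilbertForm F z) u v w := by
  have hA : ∀ x : HPlane, hilbertForm F z ![x] =
      x.1 0 * hilbertForm F z ![horiz 0] + x.1 1 * hilbertForm F z ![horiz 1] := by
    intro x
    conv_lhs => rw [hplane_eq x]
    simp [hilbertForm, vert]
  have hv : hilbertForm F z ![vert] = 0 := by simp [hilbertForm, vert]
  have hα : ∀ x : HPlane, angleForm F z ![x] =
      liouvilleDensity F z / volumeDensity F z.1 * x.2 := by
    intro x
    simp [angleForm]
  have hΩ : ∀ x y : HPlane, ((volumeForm F z.1).compContinuousLinearMap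
      (ContinuousLinearMap.fst ℝ Plane ℝ)) ![x, y] =
      volumeDensity F z.1 * (x.1 0 * y.1 1 - x.1 1 * y.1 0) := by
    intro x y
    simp [volumeForm, planeDet_apply]
  simp only [wedge, hα, hΩ]
  rw [hA u, hA v, hA w, twoForm_eq (dHilbertForm F z) v w, twoForm_eq (dHilbertForm F z) u w,
    twoForm_eq (dHilbertForm F z) u v]
  have hl : liouvilleDensity F z =
      -(hilbertForm F z ![horiz 0]) * dHilbertForm F z ![vert, horiz 1]
        + hilbertForm F z ![horiz 1] * dHilbertForm F z ![vert, horiz 0] := by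
    rw [liouvilleDensity, wedge, hv]
    ring
  field_simp
  rw [hl]
  ring

/-! ## The Finsler-Laplace operator -/

/-- The integrand `L_X² (π^* f) · α(∂/∂t)` of the Finsler-Laplace operator on the fibre over `x`. -/
def laplaceIntegrand {𝕜 : Type*} [RCLike 𝕜] (F : Plane → Plane → ℝ) (f : Plane → 𝕜) (x : Plane)
    (t : ℝ) : 𝕜 :=
  (angleForm F (x, t) ![vert]) •
    lieDeriv F (lieDeriv F (fun z : HPlane => f z.1)) (x, t)

/-- The Finsler-Laplace operator of a plane domain,
`Δ^F f (x) = (n / vol(S^{n-1})) ∫_{H_x} L_X² (π^* f) α` with `n = 2`. -/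
def planeLaplacian {𝕜 : Type*} [RCLike 𝕜] (F : Plane → Plane → ℝ) (f : Plane → 𝕜) (x : Plane) : 𝕜 :=
  (2 / (2 * π) : ℝ) • ∫ t in (0 : ℝ)..(2 * π), laplaceIntegrand F f x t

section Manifold

variable {M : Type*} [TopologicalSpace M] [ChartedSpace Plane M]

/-- The expression in the chart `e` of a function `F` on the tangent bundle of a surface. -/
def localMetric (e : OpenPartialHomeomorph M Plane) (F : ∀ p : M, TangentSpace (𝓡 2) p → ℝ) :
    Plane → Plane → ℝ :=
  fun x v => F (e.symm x) (mfderiv (𝓡 2) (𝓡 2) e.symm x v)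

/-- The existence of the integral that defines `Δ^F f` at `p`, read in the chart `e`. -/
def LaplacianExistsAt {𝕜 : Type*} [RCLike 𝕜] (e : OpenPartialHomeomorph M Plane)
    (F : ∀ p : M, TangentSpace (𝓡 2) p → ℝ) (f : M → 𝕜) (p : M) : Prop :=
  IntervalIntegrable (laplaceIntegrand (localMetric e F) (f ∘ e.symm) (e p)) volume 0 (2 * π)

/-- The Finsler-Laplace operator of the surface `(M, F)`, computed in the chart `e`. -/
def finslerLaplacian {𝕜 : Type*} [RCLike 𝕜] (e : OpenPartialHomeomorph M Plane)
    (F : ∀ p : M, TangentSpace (𝓡 2) p → ℝ) (f : M → 𝕜) (p : M) : 𝕜 :=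
  planeLaplacian (localMetric e F) (f ∘ e.symm) (e p)

end Manifold

/-! ## Katok-Ziller metrics -/

section KatokZiller

variable {T : Type*} [NormedAddCommGroup T] [NormedSpace ℝ T]

/-- The Legendre transform `d (N² / 2)` from a tangent space to its dual (the norm of `T` serves only
as a topology). -/
def legendre (N : T → ℝ) (v : T) : StrongDual ℝ T :=
  fderiv ℝ (fun w => N w ^ 2 / 2) v

/-- The Hamiltonian `H₀ = F₀ ∘ 𝓛₀⁻¹` on the cotangent space. -/
def hamiltonian (N : T → ℝ) (η : StrongDual ℝ T) : ℝ :=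
  N (Function.invFun (legendre N) η)

/-- `H_ε = H₀ + ε H₁` with `H₁ (η) = η (V)`. -/
def deformedHamiltonian (N : T → ℝ) (V : T) (ε : ℝ) (η : StrongDual ℝ T) : ℝ :=
  hamiltonian N η + ε * η V

/-- `F_ε = H_ε ∘ 𝓛_ε⁻¹`, where `𝓛_ε = d (H_ε² / 2)` goes from the cotangent space to the tangent
space, identified with its double dual. -/
def katokZillerNorm (N : T → ℝ) (V : T) (ε : ℝ) (ξ : T) : ℝ :=
  deformedHamiltonian N V ε
    (Function.invFun (legendre (deformedHamiltonian N V ε))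
      (NormedSpace.inclusionInDoubleDual ℝ T ξ))

end KatokZiller

/-- The Katok-Ziller metric of a surface associated with the metric `F₀` and the vector field `V`. -/
def katokZiller {M : Type*} [TopologicalSpace M] [ChartedSpace Plane M]
    (F₀ : ∀ p : M, TangentSpace (𝓡 2) p → ℝ) (V : ∀ p : M, TangentSpace (𝓡 2) p) (ε : ℝ) (p : M)
    (ξ : TangentSpace (𝓡 2) p) : ℝ :=
  katokZillerNorm (T := Plane) (F₀ p) (V p) ε ξ

/-! ## The sphere -/

/-- Euclidean three-space. -/
abbrev Space : Type := EuclideanSpace ℝ (Fin 3)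

/-- The unit sphere `S²`. -/
abbrev S2 : Type := Metric.sphere (0 : Space) 1

/-- The standard Riemannian metric of `S²`, as a Finsler metric. -/
def roundMetric (p : S2) (v : TangentSpace (𝓡 2) p) : ℝ :=
  norm (E := Space) (mfderiv (𝓡 2) 𝓘(ℝ, Space) ((↑) : S2 → Space) p v)

theorem mem_sphere_space {x : Space} (h : x 0 ^ 2 + x 1 ^ 2 + x 2 ^ 2 = 1) :
    x ∈ Metric.sphere (0 : Space) 1 := by
  rw [mem_sphere_zero_iff_norm, EuclideanSpace.norm_eq, Real.sqrt_eq_one]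
  simpa [Fin.sum_univ_three] using h

theorem sphere_space_eq (p : S2) :
    (p : Space) 0 ^ 2 + (p : Space) 1 ^ 2 + (p : Space) 2 ^ 2 = 1 := by
  have h := p.2
  rw [mem_sphere_zero_iff_norm, EuclideanSpace.norm_eq, Real.sqrt_eq_one] at h
  simpa [Fin.sum_univ_three] using h

/-- The rotation of `S²` by the angle `t` about the third axis. -/
def rotation (t : ℝ) (p : S2) : S2 :=
  ⟨!₂[Real.cos t * (p : Space) 0 - Real.sin t * (p : Space) 1,
      Real.sin t * (p : Space) 0 + Real.cos t * (p : Space) 1, (p : Space) 2],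
    mem_sphere_space (by
      have h := sphere_space_eq p
      have h' := Real.sin_sq_add_cos_sq t
      simp
      linear_combination h + ((p : Space) 0 ^ 2 + (p : Space) 1 ^ 2) * h')⟩

/-- The Killing field `∂/∂θ` of `S²`, which generates the rotations about the third axis: its value
at `p` is the velocity at time `0` of the orbit of `p`. -/
def rotationField (p : S2) : TangentSpace (𝓡 2) p :=
  (mfderiv 𝓘(ℝ, ℝ) (𝓡 2) (fun t => rotation t p) 0 (1 : ℝ) : Plane)

/-- The Katok-Ziller metric `F_ε` of `S²`. -/
def katokZillerS2 (ε : ℝ) : ∀ p : S2, TangentSpace (𝓡 2) p → ℝ :=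
  katokZiller roundMetric rotationField ε

/-- The point of `S²` with spherical coordinates `(φ, θ)`, `φ` being the colatitude. -/
def spherical (φ θ : ℝ) : S2 :=
  ⟨!₂[Real.sin φ * Real.cos θ, Real.sin φ * Real.sin θ, Real.cos φ],
    mem_sphere_space (by
      have h := Real.sin_sq_add_cos_sq φ
      have h' := Real.sin_sq_add_cos_sq θ
      simp
      linear_combination h + Real.sin φ ^ 2 * h')⟩

end FinslerSurface

end

open FinslerSurface

open FinslerSurface

/-! `H_ε` is the support function of the unit disc translated by `εV`, so `F_ε` solves Zermelo's
navigation problem on the round sphere with wind `εV`: its unit vectors are `W + εV` with `W` a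
round unit vector (`katokZillerNorm_eq_zermeloNorm`). The computation is done in ℝ³. The inverse of
a chart becomes a map `r` into space, `W` a vector-valued function on the homogenized bundle, and
`V` becomes `R r` with `R = rotGen` skew.

The Hilbert form is `D⁻¹⟨W, dr⟩` with `D = 1 + ⟨W, εRr⟩`. Since `V` is Killing, the geodesic flow is
the great circle flow composed with the rotation at speed `ε`; its generator satisfies `dr(X) = W +
εRr` and `dW(X) = -r + εRW` (`isReebAt_of_fderiv`, `exists_geodesicField`, `IsReebAt.unique`). Hence
`L_X²(π^*f)` is the second derivative of an extension of `f` along a curve with velocity `W + εRr`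
and acceleration `-r + 2εRW + ε²R²r` (`lieDeriv_lieDeriv`).

On a fibre, `W` runs over the unit circle of the tangent plane. If `τ` is its angle from east
towards south, then `A ∧ dA` is a constant times `dτ / (1 + a cos τ)²` with `a = ε sin φ`
(`liouvilleDensity_eq_frame`). The normalization of `α` removes the constant and the orientation, so
the operator is a weighted average over the circle (`planeLaplacian_eq_circle_average`). In
spherical coordinates the velocity is `φ' = sin τ`, `θ' = cos τ / sin φ + ε`. The terms odd under `τ
↦ 2π - τ` average to zero, and the others reduce to the integrals of `1 / (1 + a cos τ)²` and `sin²
τ / (1 + a cos τ)²` (`circle_average`). -/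

namespace FinslerSurface

/-! ### Zermelo's navigation norm and its derivative -/

section Zermelo

variable {E : Type*} [NormedAddCommGroup E] [InnerProductSpace ℝ E]

/-- The solution `N > 0` of Zermelo's equation `‖w - N c‖ = N` for the wind `c`. -/
noncomputable def zermeloNorm (c w : E) : ℝ :=
  (√((1 - ‖c‖ ^ 2) * ‖w‖ ^ 2 + inner ℝ w c ^ 2) - inner ℝ w c) / (1 - ‖c‖ ^ 2)

theorem one_sub_sq_norm_pos {G : Type*} [NormedAddCommGroup G] {c : G} (hc : ‖c‖ < 1) : 0 < 1 - ‖c‖ ^ 2 := by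
  nlinarith [norm_nonneg c]

theorem zermeloNorm_radicand_pos {c w : E} (hc : ‖c‖ < 1) (hw : w ≠ 0) :
    0 < (1 - ‖c‖ ^ 2) * ‖w‖ ^ 2 + inner ℝ w c ^ 2 := by
  have := one_sub_sq_norm_pos hc
  have := norm_pos_iff.2 hw
  positivity

theorem zermeloNorm_pos {c w : E} (hc : ‖c‖ < 1) (hw : w ≠ 0) : 0 < zermeloNorm c w := by
  have h1 := one_sub_sq_norm_pos hc
  have h2 := norm_pos_iff.2 hw
  refine div_pos (sub_pos.2 ?_) h1
  refine (le_abs_self _).trans_lt ?_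
  rw [← Real.sqrt_sq_eq_abs]
  exact Real.sqrt_lt_sqrt (sq_nonneg _) (by nlinarith [mul_pos h1 (pow_pos h2 2)])

/-- This is Zermelo's equation squared. It holds for every `w`, so it can be differentiated as an
identity. -/
theorem zermeloNorm_quadratic {c : E} (hc : ‖c‖ < 1) (w : E) :
    (1 - ‖c‖ ^ 2) * zermeloNorm c w ^ 2 + 2 * inner ℝ w c * zermeloNorm c w - ‖w‖ ^ 2 = 0 := by
  have h1 := one_sub_sq_norm_pos hc
  have h2 := Real.sq_sqrt (show 0 ≤ (1 - ‖c‖ ^ 2) * ‖w‖ ^ 2 + inner ℝ w c ^ 2 by positivity)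
  rw [zermeloNorm]
  set s := √((1 - ‖c‖ ^ 2) * ‖w‖ ^ 2 + inner ℝ w c ^ 2)
  field_simp
  linear_combination h2

theorem norm_sub_smul_sq (c w : E) (N : ℝ) :
    ‖w - N • c‖ ^ 2 = ‖w‖ ^ 2 - 2 * N * inner ℝ w c + N ^ 2 * ‖c‖ ^ 2 := by
  rw [norm_sub_sq_real, inner_smul_right, norm_smul, mul_pow, Real.norm_eq_abs, sq_abs]
  ring

theorem norm_sub_zermeloNorm_smul {c w : E} (hc : ‖c‖ < 1) (hw : w ≠ 0) :
    ‖w - zermeloNorm c w • c‖ = zermeloNorm c w := by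
  rw [← sq_eq_sq₀ (norm_nonneg _) (zermeloNorm_pos hc hw).le, norm_sub_smul_sq]
  linarith [zermeloNorm_quadratic hc w]

/-- The two roots of the quadratic have product `-‖w‖² / (1 - ‖c‖²) < 0`, so only one of them is
positive. -/
theorem eq_zermeloNorm {c w : E} (hc : ‖c‖ < 1) (hw : w ≠ 0) {N : ℝ} (hN : 0 < N)
    (h : ‖w - N • c‖ = N) : N = zermeloNorm c w := by
  have h1 := one_sub_sq_norm_pos hc
  have h2 := norm_pos_iff.2 hw
  have hZ := zermeloNorm_pos hc hw
  have e1 := zermeloNorm_quadratic hc w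
  have e2 := norm_sub_smul_sq c w N
  rw [h] at e2
  by_contra hne
  have e3 : (N - zermeloNorm c w) *
      ((1 - ‖c‖ ^ 2) * (N + zermeloNorm c w) + 2 * inner ℝ w c) = 0 := by
    linear_combination e2 - e1
  rcases mul_eq_zero.1 e3 with e4 | e4
  · exact hne (by linarith)
  · have : (1 - ‖c‖ ^ 2) * N * zermeloNorm c w = - ‖w‖ ^ 2 := by
      linear_combination zermeloNorm c w * e4 - e1
    have : 0 < (1 - ‖c‖ ^ 2) * N * zermeloNorm c w := by positivity
    nlinarith

theorem contDiffAt_zermeloNorm {n : WithTop ℕ∞} {c w : E} (hc : ‖c‖ < 1) (hw : w ≠ 0) :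
    ContDiffAt ℝ n (fun q : E × E => zermeloNorm q.1 q.2) (c, w) := by
  unfold zermeloNorm
  have h1 : ContDiffAt ℝ n (fun q : E × E => 1 - ‖q.1‖ ^ 2) (c, w) :=
    contDiffAt_const.sub (contDiff_fst.contDiffAt.norm_sq ℝ)
  have h2 : ContDiffAt ℝ n (fun q : E × E => inner ℝ q.2 q.1) (c, w) :=
    contDiff_snd.contDiffAt.inner ℝ contDiff_fst.contDiffAt
  refine ContDiffAt.div (ContDiffAt.sub (ContDiffAt.sqrt ?_ ?_) h2) h1
    (one_sub_sq_norm_pos hc).ne'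
  · exact (h1.mul (contDiff_snd.contDiffAt.norm_sq ℝ)).add (h2.pow 2)
  · exact (zermeloNorm_radicand_pos hc hw).ne'

/-- The wind-free unit velocity `w / N - c`. -/
noncomputable def airVelocity (c w : E) : E := (zermeloNorm c w)⁻¹ • w - c

theorem norm_airVelocity {c w : E} (hc : ‖c‖ < 1) (hw : w ≠ 0) : ‖airVelocity c w‖ = 1 := by
  have hZ := zermeloNorm_pos hc hw
  have : airVelocity c w = (zermeloNorm c w)⁻¹ • (w - zermeloNorm c w • c) := by
    rw [airVelocity, smul_sub, inv_smul_smul₀ hZ.ne']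
  rw [this, norm_smul, norm_sub_zermeloNorm_smul hc hw, norm_inv, Real.norm_of_nonneg hZ.le,
    inv_mul_cancel₀ hZ.ne']

theorem one_add_inner_pos {c u : E} (hc : ‖c‖ < 1) (hu : ‖u‖ = 1) : 0 < 1 + inner ℝ u c := by
  have := abs_le.1 (abs_real_inner_le_norm u c)
  rw [hu] at this
  linarith [this.1]

/-- Implicit differentiation of the quadratic. Geometrically, the indicatrix is the unit sphere
translated by `c`, so its normal at `u + c` is `u`; the factor makes the covector equal to `1` on `u
+ c`. -/
theorem hasFDerivAt_zermeloNorm {c w : E} (hc : ‖c‖ < 1) (hw : w ≠ 0) :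
    HasFDerivAt (zermeloNorm c)
      ((1 + inner ℝ (airVelocity c w) c)⁻¹ • innerSL ℝ (airVelocity c w)) w := by
  have hZ := zermeloNorm_pos hc hw
  have hd : DifferentiableAt ℝ (zermeloNorm c) w := by
    have h := (contDiffAt_zermeloNorm (n := 1) hc hw).differentiableAt one_ne_zero
    exact h.comp (f := fun w' : E => (c, w')) w (by fun_prop)
  have h0 := hd.hasFDerivAt
  set Z' := fderiv ℝ (zermeloNorm c) w
  have hi : HasFDerivAt (fun w' : E => inner ℝ w' c) (innerSL ℝ c) w := by
    have := (innerSL ℝ c).hasFDerivAt (x := w)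
    refine this.congr_of_eventuallyEq (Filter.Eventually.of_forall fun y => ?_)
    simp [real_inner_comm]
  have hn : HasFDerivAt (fun w' : E => ‖w'‖ ^ 2) (2 • innerSL ℝ w) w :=
    (hasStrictFDerivAt_norm_sq w).hasFDerivAt
  have hq := (((h0.pow 2).const_mul (1 - ‖c‖ ^ 2)).add ((hi.const_mul 2).mul h0)).sub hn
  have hz : (fun w' : E => (1 - ‖c‖ ^ 2) * zermeloNorm c w' ^ 2 +
      2 * inner ℝ w' c * zermeloNorm c w' - ‖w'‖ ^ 2) = fun _ => 0 :=
    funext fun w' => zermeloNorm_quadratic hc w'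
  have hq' := hq.unique (f := fun w' : E => (1 - ‖c‖ ^ 2) * zermeloNorm c w' ^ 2 +
      2 * inner ℝ w' c * zermeloNorm c w' - ‖w'‖ ^ 2) (by rw [hz]; exact hasFDerivAt_const 0 w)
  have hD := one_add_inner_pos hc (norm_airVelocity hc hw)
  have key : Z' = (1 + inner ℝ (airVelocity c w) c)⁻¹ • innerSL ℝ (airVelocity c w) := by
    ext v
    have e := DFunLike.congr_fun hq' v
    simp at e
    have e1 : inner ℝ (airVelocity c w) c =
        (zermeloNorm c w)⁻¹ * inner ℝ w c - ‖c‖ ^ 2 := by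
      rw [airVelocity, inner_sub_left, inner_smul_left, real_inner_self_eq_norm_sq]; simp
    have e2 : inner ℝ (airVelocity c w) v =
        (zermeloNorm c w)⁻¹ * inner ℝ w v - inner ℝ c v := by
      rw [airVelocity, inner_sub_left, inner_smul_left]; simp
    simp only [smul_apply, innerSL_apply_apply, smul_eq_mul]
    rw [eq_inv_mul_iff_mul_eq₀ hD.ne', e1, e2]
    field_simp
    linear_combination e / 2
  rw [← key]
  exact h0

end Zermelo

/-! ### The Katok-Ziller norm as a Zermelo norm -/

section KatokZillerNorm

variable {T E : Type*} [NormedAddCommGroup T] [NormedSpace ℝ T]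
  [NormedAddCommGroup E] [InnerProductSpace ℝ E]

theorem legendre_norm (L : T →L[ℝ] E) (v : T) :
    legendre (fun w => ‖L w‖) v = (innerSL ℝ (L v)).comp L := by
  have h := ((hasStrictFDerivAt_norm_sq (L v)).hasFDerivAt.comp v L.hasFDerivAt).mul_const
    (2⁻¹ : ℝ)
  refine HasFDerivAt.fderiv ?_
  have e : (2⁻¹ : ℝ) • ((2 • innerSL ℝ (L v)).comp L) = (innerSL ℝ (L v)).comp L := by
    ext w; simp
  rw [← e]
  exact h

variable [FiniteDimensional ℝ T]

/-- Riesz representation for the inner product pulled back by `L`, which need not induce the given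
norm of `T`. The map `S` is the inverse of the undeformed Legendre transform. -/
theorem exists_equiv_inner (L : T →L[ℝ] E) (hL : Function.Injective L) :
    ∃ S : StrongDual ℝ T ≃L[ℝ] T, ∀ η ζ, η ζ = inner ℝ (L (S η)) (L ζ) := by
  let B : T →ₗ[ℝ] StrongDual ℝ T :=
    { toFun := fun v => (innerSL ℝ (L v)).comp L
      map_add' := by intro x y; ext; simp
      map_smul' := by intro a x; ext; simp }
  have hinj : Function.Injective B := by
    rw [injective_iff_map_eq_zero]
    intro v hv
    have : inner ℝ (L v) (L v) = 0 := DFunLike.congr_fun hv v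
    exact hL (by simpa using inner_self_eq_zero.1 this)
  have hfin : Module.finrank ℝ T = Module.finrank ℝ (StrongDual ℝ T) := by
    rw [← (LinearMap.toContinuousLinearMap (𝕜 := ℝ) (E := T) (F' := ℝ)).finrank_eq]
    exact (Subspace.dual_finrank_eq (K := ℝ) (V := T)).symm
  let Be := (LinearEquiv.ofInjectiveOfFinrankEq B hinj hfin).toContinuousLinearEquiv
  refine ⟨Be.symm, fun η ζ => ?_⟩
  have h : B (Be.symm η) = η := Be.apply_symm_apply η
  exact (DFunLike.congr_fun h ζ).symm

/-- Write `c = ε • L V` and `K = L ∘ S`. Then `H η = ‖K η‖ + ⟨K η, c⟩`, and the differential of `H²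
/ 2` at `η ≠ 0` is `H η` times the vector whose image under `L` is `K η / ‖K η‖ + c`. If this is
`ξ`, then `‖L ξ - H η • c‖ = H η`, which is Zermelo's equation for `H η`. -/
theorem katokZillerNorm_eq_zermeloNorm (L : T →L[ℝ] E) (hL : Function.Injective L) {V : T} {ε : ℝ}
    (hV : ‖ε • L V‖ < 1) {ξ : T} (hξ : ξ ≠ 0) :
    katokZillerNorm (fun w => ‖L w‖) V ε ξ = zermeloNorm (ε • L V) (L ξ) := by
  obtain ⟨S, hS⟩ := exists_equiv_inner L hL
  have hLξ : L ξ ≠ 0 := fun h => hξ (hL (by simpa using h))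
  have hleg : ∀ v η, legendre (fun w => ‖L w‖) v = η ↔ v = S η := by
    intro v η
    rw [legendre_norm]
    constructor
    · intro h
      have h1 : ∀ ζ, inner ℝ (L v - L (S η)) (L ζ) = 0 := by
        intro ζ
        rw [inner_sub_left, ← hS, ← h]; simp
      have h2 := h1 (v - S η)
      rw [← map_sub] at h2
      exact sub_eq_zero.1 (hL (by simpa using inner_self_eq_zero.1 h2))
    · rintro rfl
      ext ζ
      exact (hS η ζ).symm
  have hH : deformedHamiltonian (fun w => ‖L w‖) V ε =
      fun η => ‖L (S η)‖ + inner ℝ (L (S η)) (ε • L V) := by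
    ext η
    have h : Function.invFun (legendre (fun w => ‖L w‖)) η = S η :=
      (hleg _ _).1 (Function.invFun_eq ⟨S η, (hleg _ _).2 rfl⟩)
    rw [deformedHamiltonian, hamiltonian, h, hS η V, inner_smul_right]
  set H := deformedHamiltonian (fun w => ‖L w‖) V ε with hHdef
  let K : StrongDual ℝ T →L[ℝ] E := L.comp (S : StrongDual ℝ T →L[ℝ] T)
  have hK : ∀ η, K η = L (S η) := fun _ => rfl
  have hHpos : ∀ η, η ≠ 0 → 0 < H η := by
    intro η hη
    have h0 : K η ≠ 0 := fun h => hη (S.injective (hL (by simpa [K] using h)))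
    have h1 := norm_pos_iff.2 h0
    have h2 := abs_le.1 (abs_real_inner_le_norm (K η) (ε • L V))
    have h3 : ‖K η‖ * ‖ε • L V‖ < ‖K η‖ * 1 := mul_lt_mul_of_pos_left hV h1
    rw [hH]
    change 0 < ‖K η‖ + inner ℝ (K η) (ε • L V)
    linarith [h2.1]
  have hbd : ∀ η, |H η| ≤ 2 * ‖K η‖ := by
    intro η
    rw [hH]
    change |‖K η‖ + inner ℝ (K η) (ε • L V)| ≤ _
    have h2 := abs_real_inner_le_norm (K η) (ε • L V)
    have h3 : ‖K η‖ * ‖ε • L V‖ ≤ ‖K η‖ * 1 := mul_le_mul_of_nonneg_left hV.le (norm_nonneg _)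
    refine (abs_add_le _ _).trans ?_
    rw [abs_norm]
    linarith
  -- `H` is not differentiable at `0` in general, but `H²` is of order two there. This is needed to
  -- exclude `0` as a preimage of `ξ`.
  have hzero : legendre H 0 = 0 := by
    refine HasFDerivAt.fderiv ?_
    have h0 : H 0 = 0 := by rw [hH]; simp
    refine HasFDerivAt.of_isLittleO ?_
    simp only [h0, sub_zero]
    have hO : (fun η => H η ^ 2 / 2) =O[nhds 0] fun η : StrongDual ℝ T => ‖η‖ ^ 2 := by
      refine Asymptotics.IsBigO.of_bound (2 * ‖K‖ ^ 2) (Filter.Eventually.of_forall fun η => ?_)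
      have h1 := (hbd η).trans (mul_le_mul_of_nonneg_left (K.le_opNorm η) zero_le_two)
      have h2 := pow_le_pow_left₀ (abs_nonneg _) h1 2
      rw [sq_abs] at h2
      simp only [Real.norm_eq_abs, abs_pow, abs_norm]
      rw [abs_of_nonneg (by positivity)]
      nlinarith
    have := hO.trans_isLittleO (Asymptotics.isLittleO_norm_pow_id one_lt_two)
    simpa using this
  have hderiv : ∀ η, η ≠ 0 → ∀ χ, legendre H η χ =
      χ (H η • ((‖K η‖)⁻¹ • S η + ε • V)) := by
    intro η hη χ
    have h0 : K η ≠ 0 := fun h => hη (S.injective (hL (by simpa [K] using h)))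
    have h1 : HasFDerivAt (fun η => ‖K η‖) ((‖K η‖⁻¹ • innerSL ℝ (K η)).comp K) η := by
      have ha := (hasStrictFDerivAt_norm_sq (K η)).hasFDerivAt.sqrt
        (by simpa using h0)
      simp only [Real.sqrt_sq (norm_nonneg _)] at ha
      have := ha.comp η K.hasFDerivAt
      have e : (‖K η‖⁻¹ • innerSL ℝ (K η)).comp K =
          ((1 / (2 * ‖K η‖)) • 2 • innerSL ℝ (K η)).comp K := by
        ext x
        simp
        ring
      rw [e]
      exact this
    have h2 : HasFDerivAt (fun η => inner ℝ (K η) (ε • L V)) ((innerSL ℝ (ε • L V)).comp K) η := by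
      have := ((innerSL ℝ (ε • L V)).comp K).hasFDerivAt (x := η)
      refine this.congr_of_eventuallyEq (Filter.Eventually.of_forall fun y => ?_)
      simp [real_inner_comm, inner_smul_left]
    have h3 : HasFDerivAt H
        ((‖K η‖⁻¹ • innerSL ℝ (K η)).comp K + (innerSL ℝ (ε • L V)).comp K) η := by
      rw [hH]; exact h1.add h2
    have h4 := (h3.pow 2).mul_const (2⁻¹ : ℝ)
    have h5 : legendre H η = _ := h4.fderiv
    rw [h5, hS χ, ← hK χ]
    simp only [map_smul, map_add, ← hK η, inner_smul_right, inner_add_right,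
      smul_apply, add_apply, ContinuousLinearMap.comp_apply, innerSL_apply_apply, smul_eq_mul,
      real_inner_comm]
    simp
    ring
  have hZ := zermeloNorm_pos hV hLξ
  have hu := norm_airVelocity hV hLξ
  -- `Function.invFun` is a genuine preimage only on the range. The witness is dual to a positive
  -- multiple `k` of `v = ξ / Z - εV`, whose image `u` under `L` is a unit vector; `k = Z / D` is
  -- forced by `H = k (1 + ⟨u, c⟩) = k D = Z`.
  have hex : ∃ η, legendre H η = NormedSpace.inclusionInDoubleDual ℝ T ξ := by
    have hD := one_add_inner_pos hV hu
    set Z := zermeloNorm (ε • L V) (L ξ)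
    let v : T := Z⁻¹ • ξ - ε • V
    have hv : L v = airVelocity (ε • L V) (L ξ) := by simp [v, airVelocity, Z]
    set D := 1 + inner ℝ (airVelocity (ε • L V) (L ξ)) (ε • L V) with hDdef
    have hk : 0 < Z / D := div_pos hZ hD
    refine ⟨S.symm ((Z / D) • v), ?_⟩
    have hne : S.symm ((Z / D) • v) ≠ 0 := by
      intro h
      have h' : (Z / D) • v = 0 := by simpa using h
      rcases smul_eq_zero.1 h' with h | h
      · exact hk.ne' h
      · rw [h, map_zero] at hv
        rw [← hv] at hu
        simp at hu
    have hKη : K (S.symm ((Z / D) • v)) = (Z / D) • airVelocity (ε • L V) (L ξ) := by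
      rw [hK, S.apply_symm_apply, map_smul, hv]
    have hHη : H (S.symm ((Z / D) • v)) = Z := by
      rw [hH]
      simp only [← hK]
      rw [hKη, norm_smul, inner_smul_left, hu, Real.norm_of_nonneg hk.le]
      simp only [conj_trivial]
      rw [← mul_add, ← hDdef]
      field_simp
    ext χ
    rw [hderiv _ hne, hHη, hKη, norm_smul, hu, Real.norm_of_nonneg hk.le, S.apply_symm_apply,
      mul_one, inv_smul_smul₀ hk.ne']
    simp only [v, sub_add_cancel, smul_inv_smul₀ hZ.ne']
    simp
  have hspec := Function.invFun_eq hex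
  rw [katokZillerNorm]
  rw [← hHdef]
  set η := Function.invFun (legendre H) (NormedSpace.inclusionInDoubleDual ℝ T ξ)
  have hη : η ≠ 0 := by
    intro h
    rw [h, hzero] at hspec
    obtain ⟨χ, hχ⟩ := SeparatingDual.exists_ne_zero (R := ℝ) hξ
    have := DFunLike.congr_fun hspec χ
    simp at this
    exact hχ this.symm
  have hξη : ξ = H η • ((‖K η‖)⁻¹ • S η + ε • V) := by
    by_contra hne
    obtain ⟨χ, hχ⟩ := SeparatingDual.exists_separating_of_ne (R := ℝ) hne
    apply hχ
    rw [← hderiv η hη χ, hspec]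
    simp
  have hHη := hHpos η hη
  refine eq_zermeloNorm hV hLξ hHη ?_
  have h0 : K η ≠ 0 := fun h => hη (S.injective (hL (by simpa [K] using h)))
  have : L ξ - H η • ε • L V = (H η * ‖K η‖⁻¹) • K η := by
    conv_lhs => rw [hξη]
    rw [hK η]
    simp only [map_smul, map_add, smul_add, mul_smul]
    abel
  rw [this, norm_smul, norm_mul, norm_inv, norm_norm, mul_assoc,
    inv_mul_cancel₀ (norm_ne_zero_iff.2 h0), mul_one, Real.norm_of_nonneg hHη.le]

end KatokZillerNorm

/-! ### Frames -/

/-- The generator of the rotations of space about the third axis. -/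
noncomputable def rotGen : Space →L[ℝ] Space :=
  LinearMap.toContinuousLinearMap
    { toFun := fun p => !₂[-p 1, p 0, 0]
      map_add' := by intro x y; ext i; fin_cases i <;> simp [add_comm]
      map_smul' := by intro a x; ext i; fin_cases i <;> simp }

theorem rotGen_apply (p : Space) : rotGen p = !₂[-p 1, p 0, 0] := rfl

theorem space_inner (p q : Space) : inner ℝ p q = p 0 * q 0 + p 1 * q 1 + p 2 * q 2 := by
  simp [PiLp.inner_apply, Fin.sum_univ_three, mul_comm]

theorem inner_rotGen_left (p q : Space) : inner ℝ (rotGen p) q = -inner ℝ p (rotGen q) := by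
  simp only [space_inner, rotGen_apply]
  simp

theorem inner_rotGen_self (p : Space) : inner ℝ p (rotGen p) = 0 := by
  have := inner_rotGen_left p p
  rw [real_inner_comm] at this
  linarith

theorem norm_rotGen_le (p : Space) : ‖rotGen p‖ ≤ ‖p‖ := by
  rw [← sq_le_sq₀ (norm_nonneg _) (norm_nonneg _), ← real_inner_self_eq_norm_sq,
    ← real_inner_self_eq_norm_sq]
  simp only [space_inner, rotGen_apply]
  simp
  nlinarith [mul_self_nonneg (p 2)]

theorem norm_smul_rotGen_lt {ε : ℝ} (hε : |ε| < 1) {p : Space} (hp : ‖p‖ = 1) :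
    ‖ε • rotGen p‖ < 1 := by
  rw [norm_smul, Real.norm_eq_abs]
  have := norm_rotGen_le p
  rw [hp] at this
  nlinarith [abs_nonneg ε, norm_nonneg (rotGen p)]

section Frame

variable {E : Type*} [NormedAddCommGroup E] [InnerProductSpace ℝ E]

theorem eq_of_inner_frame (b : OrthonormalBasis (Fin 3) ℝ E) {v : E} (h : inner ℝ (b 0) v = 0) :
    v = inner ℝ (b 1) v • b 1 + inner ℝ (b 2) v • b 2 := by
  conv_lhs => rw [← b.sum_repr' v]
  simp [Fin.sum_univ_three, h]

theorem inner_eq_frame (b : OrthonormalBasis (Fin 3) ℝ E) {u : E} (h : inner ℝ (b 0) u = 0)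
    (v : E) : inner ℝ u v = inner ℝ (b 1) u * inner ℝ (b 1) v
      + inner ℝ (b 2) u * inner ℝ (b 2) v := by
  rw [← b.sum_inner_mul_inner u v]
  have h' : inner ℝ u (b 0) = 0 := by rw [real_inner_comm, h]
  rw [Fin.sum_univ_three, h', real_inner_comm u (b 1), real_inner_comm u (b 2)]
  ring

theorem exists_frame (hE : Module.finrank ℝ E = 3) {p : E} (hp : ‖p‖ = 1) :
    ∃ b : OrthonormalBasis (Fin 3) ℝ E, b 0 = p := by
  have : FiniteDimensional ℝ E := FiniteDimensional.of_finrank_pos (by omega)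
  have hv : Orthonormal ℝ (({0} : Set (Fin 3)).domRestrict fun _ => p) := by
    constructor
    · intro i; exact hp
    · intro i j hij
      exact absurd (Subsingleton.elim i j) hij
  obtain ⟨b, hb⟩ := hv.exists_orthonormalBasis_extension_of_card_eq (by simp [hE])
  exact ⟨b, hb 0 rfl⟩

end Frame

/-! ### Rays -/

theorem ray_ne_zero (t : ℝ) : ray t ≠ 0 := by
  intro h
  have h0 : Real.cos t = 0 := by simpa [ray] using congrArg (fun v : Plane => v 0) h
  have h1 : Real.sin t = 0 := by simpa [ray] using congrArg (fun v : Plane => v 1) h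
  have := Real.sin_sq_add_cos_sq t
  simp [h0, h1] at this

theorem ray_zero (t : ℝ) : ray t 0 = Real.cos t := rfl

theorem ray_one (t : ℝ) : ray t 1 = Real.sin t := rfl

theorem contDiff_ray {n : WithTop ℕ∞} : ContDiff ℝ n ray := by
  refine contDiff_euclidean.2 fun i => ?_
  fin_cases i
  · simpa [ray] using Real.contDiff_cos
  · simpa [ray] using Real.contDiff_sin

theorem hasDerivAt_ray (t : ℝ) : HasDerivAt ray !₂[-Real.sin t, Real.cos t] t := by
  have h : DifferentiableAt ℝ ray t := (contDiff_ray (n := 1)).differentiable one_ne_zero t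
  have h' := h.hasDerivAt
  have : deriv ray t = !₂[-Real.sin t, Real.cos t] := by
    have e : ∀ i, (deriv ray t) i = deriv (fun s => ray s i) t := fun i =>
      (((EuclideanSpace.proj i : Plane →L[ℝ] ℝ).hasFDerivAt.comp_hasDerivAt t h').deriv).symm
    ext i
    rw [e]
    fin_cases i <;> simp [ray]
  rwa [this] at h'

/-! ### Immersions into the sphere -/

/-- An immersion of the plane domain `U` into the unit sphere. -/
structure SphereImmersion (r : Plane → Space) (U : Set Plane) : Prop where
  isOpen : IsOpen U
  contDiffAt : ∀ x ∈ U, ContDiffAt ℝ 2 r x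
  norm_eq : ∀ x ∈ U, ‖r x‖ = 1
  injective : ∀ x ∈ U, Function.Injective (fderiv ℝ r x)

/-- The velocity relative to the wind `ε ∂/∂θ` of the unit tangent vector in a given direction. -/
noncomputable def relVelocity (r : Plane → Space) (ε : ℝ) (z : HPlane) : Space :=
  airVelocity (ε • rotGen (r z.1)) (fderiv ℝ r z.1 (ray z.2))

/-- The conformal factor between the Hilbert forms of the deformed and of the round metric. -/
noncomputable def hilbertFactor (r : Plane → Space) (ε : ℝ) (z : HPlane) : ℝ :=
  1 + inner ℝ (relVelocity r ε z) (ε • rotGen (r z.1))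

/-! ### Regularity and first-order identities of the relative velocity -/

namespace SphereImmersion

variable {r : Plane → Space} {U : Set Plane} {ε : ℝ} {z : HPlane}

theorem inner_fderiv (h : SphereImmersion r U) {x : Plane} (hx : x ∈ U) (v : Plane) :
    inner ℝ (r x) (fderiv ℝ r x v) = 0 := by
  have hd := ((h.contDiffAt x hx).differentiableAt two_ne_zero).hasFDerivAt
  have h1 := hd.norm_sq
  have h2 : (fun y => ‖r y‖ ^ 2) =ᶠ[nhds x] fun _ => 1 := by
    filter_upwards [h.isOpen.mem_nhds hx] with y hy
    simp [h.norm_eq y hy]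
  have h3 := (h1.congr_of_eventuallyEq h2.symm).unique (hasFDerivAt_const (1 : ℝ) x)
  have := DFunLike.congr_fun h3 v
  simpa using this

theorem fderiv_ne_zero (h : SphereImmersion r U) {x : Plane} (hx : x ∈ U) {v : Plane}
    (hv : v ≠ 0) : fderiv ℝ r x v ≠ 0 := fun h0 =>
  hv (h.injective x hx (by simpa using h0))

theorem norm_wind_lt (h : SphereImmersion r U) (hε : |ε| < 1) {x : Plane} (hx : x ∈ U) :
    ‖ε • rotGen (r x)‖ < 1 := norm_smul_rotGen_lt hε (h.norm_eq x hx)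

theorem norm_relVelocity (h : SphereImmersion r U) (hε : |ε| < 1) (hz : z.1 ∈ U) :
    ‖relVelocity r ε z‖ = 1 :=
  norm_airVelocity (h.norm_wind_lt hε hz) (h.fderiv_ne_zero hz (ray_ne_zero _))

theorem inner_relVelocity (h : SphereImmersion r U) (hz : z.1 ∈ U) :
    inner ℝ (r z.1) (relVelocity r ε z) = 0 := by
  rw [relVelocity, airVelocity, inner_sub_right, inner_smul_right, inner_smul_right,
    h.inner_fderiv hz, inner_rotGen_self]
  ring

theorem hilbertFactor_pos (h : SphereImmersion r U) (hε : |ε| < 1) (hz : z.1 ∈ U) :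
    0 < hilbertFactor r ε z :=
  one_add_inner_pos (h.norm_wind_lt hε hz) (h.norm_relVelocity hε hz)

theorem contDiffAt_fderiv (h : SphereImmersion r U) (hz : z.1 ∈ U) :
    ContDiffAt ℝ 1 (fun z : HPlane => fderiv ℝ r z.1) z :=
  ((h.contDiffAt z.1 hz).fderiv_right (m := 1) (by norm_num)).comp z contDiffAt_fst

theorem contDiffAt_base (h : SphereImmersion r U) (hz : z.1 ∈ U) :
    ContDiffAt ℝ 2 (fun z : HPlane => r z.1) z :=
  (h.contDiffAt z.1 hz).comp z contDiffAt_fst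

theorem contDiffAt_wind (h : SphereImmersion r U) (hz : z.1 ∈ U) :
    ContDiffAt ℝ 2 (fun z : HPlane => ε • rotGen (r z.1)) z :=
  (rotGen.contDiff.contDiffAt.comp z (h.contDiffAt_base hz)).const_smul ε

theorem contDiffAt_fderiv_ray (h : SphereImmersion r U) (hz : z.1 ∈ U) :
    ContDiffAt ℝ 1 (fun z : HPlane => fderiv ℝ r z.1 (ray z.2)) z :=
  (h.contDiffAt_fderiv hz).clm_apply (contDiff_ray.contDiffAt.comp z contDiffAt_snd)

theorem contDiffAt_zermeloNorm (h : SphereImmersion r U) (hε : |ε| < 1) (hz : z.1 ∈ U) :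
    ContDiffAt ℝ 1 (fun z : HPlane =>
      zermeloNorm (ε • rotGen (r z.1)) (fderiv ℝ r z.1 (ray z.2))) z :=
  ContDiffAt.comp (f := fun z : HPlane => (ε • rotGen (r z.1), fderiv ℝ r z.1 (ray z.2))) z
    (FinslerSurface.contDiffAt_zermeloNorm (n := 1) (h.norm_wind_lt hε hz)
      (h.fderiv_ne_zero hz (ray_ne_zero z.2)))
    (((h.contDiffAt_wind hz).of_le one_le_two).prodMk (h.contDiffAt_fderiv_ray hz))

theorem zermeloNorm_pos (h : SphereImmersion r U) (hε : |ε| < 1) (hz : z.1 ∈ U) :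
    0 < zermeloNorm (ε • rotGen (r z.1)) (fderiv ℝ r z.1 (ray z.2)) :=
  FinslerSurface.zermeloNorm_pos (h.norm_wind_lt hε hz) (h.fderiv_ne_zero hz (ray_ne_zero _))

theorem contDiffAt_relVelocity (h : SphereImmersion r U) (hε : |ε| < 1) (hz : z.1 ∈ U) :
    ContDiffAt ℝ 1 (relVelocity r ε) z :=
  (((h.contDiffAt_zermeloNorm hε hz).inv (h.zermeloNorm_pos hε hz).ne').smul
    (h.contDiffAt_fderiv_ray hz)).sub ((h.contDiffAt_wind hz).of_le one_le_two)

theorem differentiableAt_relVelocity (h : SphereImmersion r U) (hε : |ε| < 1) (hz : z.1 ∈ U) :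
    DifferentiableAt ℝ (relVelocity r ε) z :=
  (h.contDiffAt_relVelocity hε hz).differentiableAt one_ne_zero

theorem eventually_mem (h : SphereImmersion r U) (hz : z.1 ∈ U) :
    ∀ᶠ y : HPlane in nhds z, y.1 ∈ U :=
  continuousAt_fst.eventually (h.isOpen.mem_nhds hz)

theorem hasFDerivAt_base (h : SphereImmersion r U) (hz : z.1 ∈ U) :
    HasFDerivAt (fun z : HPlane => r z.1)
      ((fderiv ℝ r z.1).comp (ContinuousLinearMap.fst ℝ Plane ℝ)) z :=
  ((h.contDiffAt z.1 hz).differentiableAt two_ne_zero).hasFDerivAt.comp z hasFDerivAt_fst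

theorem inner_fderiv_relVelocity_self (h : SphereImmersion r U) (hε : |ε| < 1) (hz : z.1 ∈ U)
    (u : HPlane) : inner ℝ (relVelocity r ε z) (fderiv ℝ (relVelocity r ε) z u) = 0 := by
  have h1 := (h.differentiableAt_relVelocity hε hz).hasFDerivAt.norm_sq
  have h2 : (fun y => ‖relVelocity r ε y‖ ^ 2) =ᶠ[nhds z] fun _ => 1 := by
    filter_upwards [h.eventually_mem hz] with y hy
    simp [h.norm_relVelocity hε hy]
  have h3 := (h1.congr_of_eventuallyEq h2.symm).unique (hasFDerivAt_const (1 : ℝ) z)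
  simpa using DFunLike.congr_fun h3 u

theorem inner_fderiv_relVelocity_base (h : SphereImmersion r U) (hε : |ε| < 1) (hz : z.1 ∈ U)
    (u : HPlane) : inner ℝ (r z.1) (fderiv ℝ (relVelocity r ε) z u) =
      -inner ℝ (relVelocity r ε z) (fderiv ℝ r z.1 u.1) := by
  have h1 := (h.hasFDerivAt_base hz).inner ℝ (h.differentiableAt_relVelocity hε hz).hasFDerivAt
  have h2 : (fun y : HPlane => inner ℝ (r y.1) (relVelocity r ε y)) =ᶠ[nhds z] fun _ => 0 := by
    filter_upwards [h.eventually_mem hz] with y hy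
    simp [h.inner_relVelocity hy]
  have h3 := (h1.congr_of_eventuallyEq h2.symm).unique (hasFDerivAt_const (0 : ℝ) z)
  have := DFunLike.congr_fun h3 u
  simp [fderivInnerCLM_apply] at this
  rw [real_inner_comm _ (relVelocity r ε z)]
  linarith

/-- Along a fibre, `W + εRr` is the image under `dr` of `N⁻¹ • ray t`. The derivative of the latter
has the nonzero component `N⁻¹` along the derivative of `ray`, and `dr` is injective. -/
theorem fderiv_relVelocity_vert_ne_zero (h : SphereImmersion r U) (hε : |ε| < 1) (hz : z.1 ∈ U) :
    fderiv ℝ (relVelocity r ε) z vert ≠ 0 := by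
  intro h0
  have hline : HasDerivAt (fun t : ℝ => ((z.1, t) : HPlane)) vert z.2 :=
    (hasDerivAt_const z.2 z.1).prodMk (hasDerivAt_id z.2)
  have h1 : HasDerivAt (fun t : ℝ => relVelocity r ε (z.1, t)) 0 z.2 := by
    rw [← h0]
    exact (h.differentiableAt_relVelocity hε hz).hasFDerivAt.comp_hasDerivAt z.2 hline
  have hN := ((h.contDiffAt_zermeloNorm hε hz).differentiableAt one_ne_zero).hasFDerivAt
    |>.comp_hasDerivAt z.2 hline
  have hi := hN.inv (h.zermeloNorm_pos hε hz).ne'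
  have hr := (fderiv ℝ r z.1).hasFDerivAt.comp_hasDerivAt z.2 (hasDerivAt_ray z.2)
  have h2 := (hi.smul hr).sub_const (ε • rotGen (r z.1))
  have h3 := h2.unique h1
  simp only [Function.comp_apply] at h3
  rw [← map_smul, ← map_smul, ← map_add] at h3
  have h4 := h.injective z.1 hz (h3.trans (map_zero _).symm)
  have e0 := congrArg (fun v : Plane => v 0) h4
  have e1 := congrArg (fun v : Plane => v 1) h4
  simp [ray_zero, ray_one] at e0 e1
  have hp := inv_pos.2 (h.zermeloNorm_pos hε hz)
  set N := (zermeloNorm (ε • rotGen (r z.1)) (fderiv ℝ r z.1 (ray z.2)))⁻¹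
  have := Real.sin_sq_add_cos_sq z.2
  -- Component of the vanishing derivative along `(-sin t, cos t)`.
  have : N = 0 := by
    linear_combination Real.cos z.2 * e1 - Real.sin z.2 * e0 - N * this
  exact hp.ne' this

end SphereImmersion

/-- `F` is, over `U`, the pull-back by `r` of the Katok-Ziller metric of the unit sphere. -/
def IsZermeloMetric (F : Plane → Plane → ℝ) (r : Plane → Space) (ε : ℝ) (U : Set Plane) : Prop :=
  ∀ x ∈ U, ∀ v : Plane, v ≠ 0 → F x v = zermeloNorm (ε • rotGen (r x)) (fderiv ℝ r x v)

/-! ### Hilbert form, contact volume and Reeb field -/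

namespace SphereImmersion

variable {F : Plane → Plane → ℝ} {r : Plane → Space} {U : Set Plane} {ε : ℝ} {z : HPlane}

/-- The Hilbert form is conformal to the one of the round metric. -/
theorem hilbertForm_eq (h : SphereImmersion r U) (hε : |ε| < 1) (hF : IsZermeloMetric F r ε U)
    (hz : z.1 ∈ U) :
    hilbertForm F z = ContinuousAlternatingMap.ofSubsingleton ℝ HPlane ℝ 0
      ((hilbertFactor r ε z)⁻¹ • (innerSL ℝ (relVelocity r ε z)).comp
        ((fderiv ℝ r z.1).comp (ContinuousLinearMap.fst ℝ Plane ℝ))) := by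
  have h1 : F z.1 =ᶠ[nhds (ray z.2)]
      fun v => zermeloNorm (ε • rotGen (r z.1)) (fderiv ℝ r z.1 v) := by
    filter_upwards [isOpen_ne.mem_nhds (ray_ne_zero z.2)] with v hv
    exact hF z.1 hz v hv
  have h2 := (hasFDerivAt_zermeloNorm (h.norm_wind_lt hε hz)
    (h.fderiv_ne_zero hz (ray_ne_zero z.2))).comp (ray z.2) (fderiv ℝ r z.1).hasFDerivAt
  rw [hilbertForm, h1.fderiv_eq]
  congr 1
  rw [show fderiv ℝ (fun v => zermeloNorm (ε • rotGen (r z.1)) (fderiv ℝ r z.1 v)) (ray z.2) = _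
    from h2.fderiv]
  rfl

theorem hilbertForm_apply (h : SphereImmersion r U) (hε : |ε| < 1) (hF : IsZermeloMetric F r ε U)
    (hz : z.1 ∈ U) (u : HPlane) :
    hilbertForm F z ![u] =
      (hilbertFactor r ε z)⁻¹ * inner ℝ (relVelocity r ε z) (fderiv ℝ r z.1 u.1) := by
  rw [h.hilbertForm_eq hε hF hz]
  simp

theorem differentiableAt_hilbertFactor (h : SphereImmersion r U) (hε : |ε| < 1) (hz : z.1 ∈ U) :
    DifferentiableAt ℝ (hilbertFactor r ε) z :=
  (differentiableAt_const _).add ((h.differentiableAt_relVelocity hε hz).inner ℝ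
    ((h.contDiffAt_wind hz).differentiableAt two_ne_zero))

theorem differentiableAt_hilbertForm (h : SphereImmersion r U) (hε : |ε| < 1)
    (hF : IsZermeloMetric F r ε U) (hz : z.1 ∈ U) : DifferentiableAt ℝ (hilbertForm F) z := by
  let Φ : (HPlane →L[ℝ] ℝ) →ₗ[ℝ] HPlane [⋀^Fin 1]→L[ℝ] ℝ :=
    { toFun := ContinuousAlternatingMap.ofSubsingleton ℝ HPlane ℝ 0
      map_add' := by intro a b; ext; simp
      map_smul' := by intro a b; ext; simp }
  have h1 : DifferentiableAt ℝ (fun z : HPlane => (hilbertFactor r ε z)⁻¹ •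
      (innerSL ℝ (relVelocity r ε z)).comp
        ((fderiv ℝ r z.1).comp (ContinuousLinearMap.fst ℝ Plane ℝ))) z := by
    refine ((h.differentiableAt_hilbertFactor hε hz).inv (h.hilbertFactor_pos hε hz).ne').smul ?_
    refine DifferentiableAt.clm_comp ?_ (DifferentiableAt.clm_comp ?_ (differentiableAt_const _))
    · exact (innerSL ℝ (E := Space)).differentiableAt.comp z (h.differentiableAt_relVelocity hε hz)
    · exact (h.contDiffAt_fderiv hz).differentiableAt one_ne_zero
  refine ((LinearMap.toContinuousLinearMap Φ).differentiableAt.comp z h1).congr_of_eventuallyEq ?_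
  filter_upwards [h.eventually_mem hz] with y hy
  exact h.hilbertForm_eq hε hF hy

theorem fderiv_hilbertForm_apply (h : SphereImmersion r U) (hε : |ε| < 1)
    (hF : IsZermeloMetric F r ε U) (hz : z.1 ∈ U) (u w : HPlane) :
    fderiv ℝ (fun y => hilbertForm F y ![w]) z u =
      (hilbertFactor r ε z)⁻¹ *
        (inner ℝ (fderiv ℝ (relVelocity r ε) z u) (fderiv ℝ r z.1 w.1)
          + inner ℝ (relVelocity r ε z) (fderiv ℝ (fderiv ℝ r) z.1 u.1 w.1))
      - (hilbertFactor r ε z)⁻¹ ^ 2 * fderiv ℝ (hilbertFactor r ε) z u *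
        inner ℝ (relVelocity r ε z) (fderiv ℝ r z.1 w.1) := by
  have hD := (hasDerivAt_inv (h.hilbertFactor_pos hε hz).ne').comp_hasFDerivAt z
    (h.differentiableAt_hilbertFactor hε hz).hasFDerivAt
  have hr : HasFDerivAt (fun y : HPlane => fderiv ℝ r y.1 w.1)
      (((fderiv ℝ (fderiv ℝ r) z.1).comp (ContinuousLinearMap.fst ℝ Plane ℝ)).flip w.1) z := by
    have h2 := (((h.contDiffAt z.1 hz).fderiv_right (m := 1) (by norm_num)).differentiableAt
      one_ne_zero).hasFDerivAt.comp z (hasFDerivAt_fst (𝕜 := ℝ) (p := z))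
    simpa using h2.clm_apply (hasFDerivAt_const w.1 z)
  have hi := (h.differentiableAt_relVelocity hε hz).hasFDerivAt.inner ℝ hr
  have hm := hD.mul hi
  have he : (fun y => hilbertForm F y ![w]) =ᶠ[nhds z] fun y : HPlane =>
      (hilbertFactor r ε y)⁻¹ * inner ℝ (relVelocity r ε y) (fderiv ℝ r y.1 w.1) := by
    filter_upwards [h.eventually_mem hz] with y hy
    exact h.hilbertForm_apply hε hF hy w
  rw [he.fderiv_eq, show fderiv ℝ (fun y : HPlane =>
      (hilbertFactor r ε y)⁻¹ * inner ℝ (relVelocity r ε y) (fderiv ℝ r y.1 w.1)) z = _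
      from hm.fderiv]
  simp [fderivInnerCLM_apply]
  ring

/-- This is `d(D⁻¹⟨W, dr⟩) = D⁻¹⟨dW ∧ dr⟩ - D⁻² dD ∧ ⟨W, dr⟩`; the second derivatives of `r` cancel
by symmetry. -/
theorem dHilbertForm_apply (h : SphereImmersion r U) (hε : |ε| < 1)
    (hF : IsZermeloMetric F r ε U) (hz : z.1 ∈ U) (u w : HPlane) :
    dHilbertForm F z ![u, w] =
      (hilbertFactor r ε z)⁻¹ *
        (inner ℝ (fderiv ℝ (relVelocity r ε) z u) (fderiv ℝ r z.1 w.1)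
          - inner ℝ (fderiv ℝ (relVelocity r ε) z w) (fderiv ℝ r z.1 u.1))
      - (hilbertFactor r ε z)⁻¹ ^ 2 *
        (fderiv ℝ (hilbertFactor r ε) z u * inner ℝ (relVelocity r ε z) (fderiv ℝ r z.1 w.1)
          - fderiv ℝ (hilbertFactor r ε) z w *
            inner ℝ (relVelocity r ε z) (fderiv ℝ r z.1 u.1)) := by
  have hsymm : fderiv ℝ (fderiv ℝ r) z.1 u.1 w.1 = fderiv ℝ (fderiv ℝ r) z.1 w.1 u.1 :=
    ((h.contDiffAt z.1 hz).isSymmSndFDerivAt (by simp)).eq u.1 w.1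
  rw [dHilbertForm, extDeriv_apply (h.differentiableAt_hilbertForm hε hF hz)]
  have e0 : (0 : Fin 2).removeNth ![u, w] = ![w] := by ext i <;> fin_cases i <;> rfl
  have e1 : (1 : Fin 2).removeNth ![u, w] = ![u] := by ext i <;> fin_cases i <;> rfl
  rw [Fin.sum_univ_two, e0, e1]
  simp only [Matrix.cons_val_zero, Matrix.cons_val_one]
  rw [h.fderiv_hilbertForm_apply hε hF hz, h.fderiv_hilbertForm_apply hε hF hz, hsymm]
  simp
  ring

theorem fderiv_hilbertFactor_apply (h : SphereImmersion r U) (hε : |ε| < 1) (hz : z.1 ∈ U)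
    (u : HPlane) : fderiv ℝ (hilbertFactor r ε) z u =
      ε * (inner ℝ (fderiv ℝ (relVelocity r ε) z u) (rotGen (r z.1))
        + inner ℝ (relVelocity r ε z) (rotGen (fderiv ℝ r z.1 u.1))) := by
  have hc := (rotGen.hasFDerivAt.comp z (h.hasFDerivAt_base hz)).const_smul ε
  have hi := ((h.differentiableAt_relVelocity hε hz).hasFDerivAt.inner ℝ hc).const_add 1
  rw [show fderiv ℝ (hilbertFactor r ε) z = _ from hi.fderiv]
  simp [fderivInnerCLM_apply, inner_smul_right]
  ring

/-- The form `A` vanishes on vertical vectors, and the term of `dA` with `dD` is a multiple of `dD ∧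
A`, which `A` annihilates. -/
theorem liouvilleDensity_eq (h : SphereImmersion r U) (hε : |ε| < 1)
    (hF : IsZermeloMetric F r ε U) (hz : z.1 ∈ U) :
    liouvilleDensity F z = (hilbertFactor r ε z)⁻¹ ^ 2 *
      (inner ℝ (relVelocity r ε z) (fderiv ℝ r z.1 (EuclideanSpace.single 1 1)) *
          inner ℝ (fderiv ℝ (relVelocity r ε) z vert) (fderiv ℝ r z.1 (EuclideanSpace.single 0 1))
        - inner ℝ (relVelocity r ε z) (fderiv ℝ r z.1 (EuclideanSpace.single 0 1)) *
          inner ℝ (fderiv ℝ (relVelocity r ε) z vert)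
            (fderiv ℝ r z.1 (EuclideanSpace.single 1 1))) := by
  have hv : vert.1 = 0 := rfl
  have hh : ∀ i, (horiz i).1 = EuclideanSpace.single i 1 := fun _ => rfl
  rw [liouvilleDensity, wedge]
  simp only [h.hilbertForm_apply hε hF hz, h.dHilbertForm_apply hε hF hz, hv, hh, map_zero,
    inner_zero_right]
  ring

/-- The angular speed of the relative velocity along a fibre, with respect to a frame. -/
noncomputable def angularSpeed (r : Plane → Space) (ε : ℝ) (b : OrthonormalBasis (Fin 3) ℝ Space)
    (z : HPlane) : ℝ :=
  inner ℝ (b 1) (relVelocity r ε z) * inner ℝ (b 2) (fderiv ℝ (relVelocity r ε) z vert)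
    - inner ℝ (b 2) (relVelocity r ε z) * inner ℝ (b 1) (fderiv ℝ (relVelocity r ε) z vert)

/-- The Jacobian of an immersion into the sphere, with respect to a frame. -/
noncomputable def frameJacobian (r : Plane → Space) (b : OrthonormalBasis (Fin 3) ℝ Space)
    (x : Plane) : ℝ :=
  inner ℝ (b 2) (fderiv ℝ r x (EuclideanSpace.single 0 1)) *
      inner ℝ (b 1) (fderiv ℝ r x (EuclideanSpace.single 1 1))
    - inner ℝ (b 1) (fderiv ℝ r x (EuclideanSpace.single 0 1)) *
      inner ℝ (b 2) (fderiv ℝ r x (EuclideanSpace.single 1 1))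

theorem inner_base_fderiv_vert (h : SphereImmersion r U) (hε : |ε| < 1) (hz : z.1 ∈ U) :
    inner ℝ (r z.1) (fderiv ℝ (relVelocity r ε) z vert) = 0 := by
  rw [h.inner_fderiv_relVelocity_base hε hz]
  simp [vert]

variable {b : OrthonormalBasis (Fin 3) ℝ Space}

/-- Multiplicativity of 2×2 determinants separates a factor that is constant on the fibre from the
speed at which `W` turns. -/
theorem liouvilleDensity_eq_frame (h : SphereImmersion r U) (hε : |ε| < 1)
    (hF : IsZermeloMetric F r ε U) (hz : z.1 ∈ U) (hb : b 0 = r z.1) :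
    liouvilleDensity F z =
      frameJacobian r b z.1 * (angularSpeed r ε b z / hilbertFactor r ε z ^ 2) := by
  have h1 : inner ℝ (b 0) (relVelocity r ε z) = 0 := by rw [hb, h.inner_relVelocity hz]
  have h2 : inner ℝ (b 0) (fderiv ℝ (relVelocity r ε) z vert) = 0 := by
    rw [hb, h.inner_base_fderiv_vert hε hz]
  rw [h.liouvilleDensity_eq hε hF hz, inner_eq_frame b h1, inner_eq_frame b h1,
    inner_eq_frame b h2, inner_eq_frame b h2, frameJacobian, angularSpeed]
  field_simp
  ring

theorem frame_relVelocity_sq (h : SphereImmersion r U) (hε : |ε| < 1) (hz : z.1 ∈ U)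
    (hb : b 0 = r z.1) :
    inner ℝ (b 1) (relVelocity r ε z) ^ 2 + inner ℝ (b 2) (relVelocity r ε z) ^ 2 = 1 := by
  have h1 : inner ℝ (b 0) (relVelocity r ε z) = 0 := by rw [hb, h.inner_relVelocity hz]
  have := inner_eq_frame b h1 (relVelocity r ε z)
  rw [real_inner_self_eq_norm_sq, h.norm_relVelocity hε hz] at this
  linarith

/-- Tangent vectors of the sphere that are orthogonal to the relative velocity. -/
theorem eq_smul_fderiv_vert (h : SphereImmersion r U) (hε : |ε| < 1) (hz : z.1 ∈ U)
    (hb : b 0 = r z.1) {δ : Space} (h0 : inner ℝ (r z.1) δ = 0)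
    (h1 : inner ℝ (relVelocity r ε z) δ = 0) :
    angularSpeed r ε b z • δ =
      (inner ℝ (b 1) (relVelocity r ε z) * inner ℝ (b 2) δ
        - inner ℝ (b 2) (relVelocity r ε z) * inner ℝ (b 1) δ) •
        fderiv ℝ (relVelocity r ε) z vert := by
  have hW : inner ℝ (b 0) (relVelocity r ε z) = 0 := by rw [hb, h.inner_relVelocity hz]
  have hV : inner ℝ (b 0) (fderiv ℝ (relVelocity r ε) z vert) = 0 := by
    rw [hb, h.inner_base_fderiv_vert hε hz]
  have hδ : inner ℝ (b 0) δ = 0 := by rw [hb, h0]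
  have hWV := h.inner_fderiv_relVelocity_self hε hz vert
  rw [inner_eq_frame b hW] at hWV h1
  have hs := h.frame_relVelocity_sq hε hz hb
  rw [angularSpeed]
  set W := relVelocity r ε z
  set V := fderiv ℝ (relVelocity r ε) z vert
  rw [eq_of_inner_frame b hδ, eq_of_inner_frame b hV]
  simp only [smul_add, smul_smul]
  have o : ∀ i j, inner ℝ (b i) (b j) = if i = j then (1 : ℝ) else 0 :=
    fun i j => orthonormal_iff_ite.1 b.orthonormal i j
  simp only [inner_add_right, inner_smul_right, o]
  simp
  congr 2
  · linear_combination inner ℝ (b 2) V * h1 - inner ℝ (b 2) δ * hWV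
  · linear_combination inner ℝ (b 1) δ * hWV - inner ℝ (b 1) V * h1

/-- The fibre derivative of `W` is orthogonal to the unit vector `W`; were it also parallel to `W`,
it would vanish. -/
theorem angularSpeed_ne_zero (h : SphereImmersion r U) (hε : |ε| < 1) (hz : z.1 ∈ U)
    (hb : b 0 = r z.1) : angularSpeed r ε b z ≠ 0 := by
  intro h0
  have h1 := h.eq_smul_fderiv_vert hε hz hb (h.inner_base_fderiv_vert hε hz)
    (h.inner_fderiv_relVelocity_self hε hz vert)
  have hW : inner ℝ (b 0) (relVelocity r ε z) = 0 := by rw [hb, h.inner_relVelocity hz]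
  have hV : inner ℝ (b 0) (fderiv ℝ (relVelocity r ε) z vert) = 0 := by
    rw [hb, h.inner_base_fderiv_vert hε hz]
  have hWV := h.inner_fderiv_relVelocity_self hε hz vert
  rw [inner_eq_frame b hW] at hWV
  have hs := h.frame_relVelocity_sq hε hz hb
  rw [angularSpeed] at h0
  refine h.fderiv_relVelocity_vert_ne_zero hε hz ?_
  set W := relVelocity r ε z
  set V := fderiv ℝ (relVelocity r ε) z vert
  rw [eq_of_inner_frame b hV,
    show inner ℝ (b 1) V = 0 by
      linear_combination inner ℝ (b 1) W * hWV - inner ℝ (b 2) W * h0 - inner ℝ (b 1) V * hs,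
    show inner ℝ (b 2) V = 0 by
      linear_combination inner ℝ (b 2) W * hWV + inner ℝ (b 1) W * h0 - inner ℝ (b 2) V * hs]
  simp

theorem frameJacobian_ne_zero (h : SphereImmersion r U) {x : Plane} (hx : x ∈ U)
    (hb : b 0 = r x) : frameJacobian r b x ≠ 0 := by
  intro h0
  rw [frameJacobian] at h0
  have hframe : ∀ {v : Space}, inner ℝ (b 0) v = 0 → inner ℝ (b 1) v = 0 → inner ℝ (b 2) v = 0 →
      v = 0 := fun {v} h1 h2 h3 => by rw [eq_of_inner_frame b h1, h2, h3]; simp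
  have hr : ∀ v, inner ℝ (b 0) (fderiv ℝ r x v) = 0 := fun v => by rw [hb, h.inner_fderiv hx]
  set e₀ : Plane := EuclideanSpace.single 0 1
  set e₁ : Plane := EuclideanSpace.single 1 1
  -- When the determinant vanishes, Cramer's combination of the two columns is zero, and injectivity
  -- of `dr` kills its coefficients.
  have key : ∀ i : Fin 3, i ≠ 0 → inner ℝ (b i) (fderiv ℝ r x e₁) = 0 := by
    intro i hi
    have : inner ℝ (b i) (fderiv ℝ r x e₁) • fderiv ℝ r x e₀ -
        inner ℝ (b i) (fderiv ℝ r x e₀) • fderiv ℝ r x e₁ = 0 := by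
      refine hframe ?_ ?_ ?_ <;> fin_cases i <;>
        simp only [inner_sub_right, inner_smul_right, hr]
      · exact absurd rfl hi
      · simp
      · simp
      · exact absurd rfl hi
      · simp; ring
      · simp; linarith
      · exact absurd rfl hi
      · simp; linarith
      · simp; ring
    rw [← map_smul, ← map_smul, ← map_sub] at this
    have h2 := h.injective x hx (this.trans (map_zero _).symm)
    simpa [e₀, e₁] using congrArg (fun v : Plane => v 0) h2
  have h3 : fderiv ℝ r x e₁ = 0 := hframe (hr e₁) (key 1 (by decide)) (key 2 (by decide))
  exact h.fderiv_ne_zero hx (v := e₁) (by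
    intro h4
    simpa [e₁] using congrArg (fun v : Plane => v 1) h4) h3

/-- The direction of the geodesic field: the sum of the great circle flow and of the rotation. -/
theorem isReebAt_of_fderiv (h : SphereImmersion r U) (hε : |ε| < 1)
    (hF : IsZermeloMetric F r ε U) (hz : z.1 ∈ U) {X : HPlane}
    (h1 : fderiv ℝ r z.1 X.1 = relVelocity r ε z + ε • rotGen (r z.1))
    (h2 : fderiv ℝ (relVelocity r ε) z X = -r z.1 + ε • rotGen (relVelocity r ε z)) :
    IsReebAt F z X := by
  have hD := (h.hilbertFactor_pos hε hz).ne'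
  have hWW : inner ℝ (relVelocity r ε z) (relVelocity r ε z) = 1 := by
    rw [real_inner_self_eq_norm_sq, h.norm_relVelocity hε hz]; norm_num
  have hA : inner ℝ (relVelocity r ε z) (fderiv ℝ r z.1 X.1) = hilbertFactor r ε z := by
    rw [h1, inner_add_right, hWW, hilbertFactor]
  -- Clairaut's relation: `⟨W, Rr⟩` is constant along `X`, because `R` is skew.
  have hDX : fderiv ℝ (hilbertFactor r ε) z X = 0 := by
    rw [h.fderiv_hilbertFactor_apply hε hz, h1, h2]
    simp only [map_add, map_smul, inner_add_left, inner_add_right, inner_neg_left,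
      inner_smul_left, inner_smul_right, inner_rotGen_self, inner_rotGen_left (relVelocity r ε z)]
    simp
  refine ⟨by rw [h.hilbertForm_apply hε hF hz, hA, inv_mul_cancel₀ hD], fun w => ?_⟩
  rw [h.dHilbertForm_apply hε hF hz, hA, hDX, h.fderiv_hilbertFactor_apply hε hz, h1, h2]
  simp only [inner_add_left, inner_add_right, inner_neg_left, inner_smul_left, inner_smul_right,
    h.inner_fderiv hz, inner_rotGen_left (relVelocity r ε z)]
  rw [real_inner_comm (relVelocity r ε z) (fderiv ℝ (relVelocity r ε) z w),
    h.inner_fderiv_relVelocity_self hε hz]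
  simp
  field_simp
  ring

theorem exists_geodesicField (h : SphereImmersion r U) (hε : |ε| < 1) (hz : z.1 ∈ U) :
    ∃ X : HPlane, fderiv ℝ r z.1 X.1 = relVelocity r ε z + ε • rotGen (r z.1) ∧
      fderiv ℝ (relVelocity r ε) z X = -r z.1 + ε • rotGen (relVelocity r ε z) := by
  obtain ⟨b, hb⟩ := exists_frame (E := Space) (by simp) (h.norm_eq z.1 hz)
  have hω := h.angularSpeed_ne_zero hε hz hb
  have hWW : inner ℝ (relVelocity r ε z) (relVelocity r ε z) = 1 := by
    rw [real_inner_self_eq_norm_sq, h.norm_relVelocity hε hz]; norm_num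
  have hrr : inner ℝ (r z.1) (r z.1) = 1 := by
    rw [real_inner_self_eq_norm_sq, h.norm_eq z.1 hz]; norm_num
  set v : Plane := (zermeloNorm (ε • rotGen (r z.1)) (fderiv ℝ r z.1 (ray z.2)))⁻¹ • ray z.2
  have hv : fderiv ℝ r z.1 v = relVelocity r ε z + ε • rotGen (r z.1) := by
    simp [v, relVelocity, airVelocity]
  -- The horizontal part `v` is dictated by the first equation. The defect `δ` in the second is
  -- orthogonal to `r` and `W`, hence a multiple of the fibre derivative of `W`, and a vertical
  -- component absorbs it.
  set δ : Space := -r z.1 + ε • rotGen (relVelocity r ε z) - fderiv ℝ (relVelocity r ε) z (v, 0)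
  have h0 : inner ℝ (r z.1) δ = 0 := by
    simp only [δ, inner_sub_right, inner_add_right, inner_neg_right, inner_smul_right, hrr,
      h.inner_fderiv_relVelocity_base hε hz, hv, hWW]
    rw [← real_inner_comm (r z.1), inner_rotGen_left]
    ring
  have h1 : inner ℝ (relVelocity r ε z) δ = 0 := by
    simp only [δ, inner_sub_right, inner_add_right, inner_neg_right, inner_smul_right,
      h.inner_fderiv_relVelocity_self hε hz, inner_rotGen_self]
    rw [real_inner_comm, h.inner_relVelocity hz]
    ring
  have h2 := h.eq_smul_fderiv_vert hε hz hb h0 h1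
  set μ := inner ℝ (b 1) (relVelocity r ε z) * inner ℝ (b 2) δ
        - inner ℝ (b 2) (relVelocity r ε z) * inner ℝ (b 1) δ
  refine ⟨(v, 0) + ((angularSpeed r ε b z)⁻¹ * μ) • vert, by simpa [vert] using hv, ?_⟩
  rw [map_add, map_smul, mul_smul, ← h2, inv_smul_smul₀ hω]
  simp [δ]

theorem liouvilleDensity_ne_zero (h : SphereImmersion r U) (hε : |ε| < 1)
    (hF : IsZermeloMetric F r ε U) (hz : z.1 ∈ U) : liouvilleDensity F z ≠ 0 := by
  obtain ⟨b, hb⟩ := exists_frame (E := Space) (by simp) (h.norm_eq z.1 hz)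
  rw [h.liouvilleDensity_eq_frame hε hF hz hb]
  exact mul_ne_zero (h.frameJacobian_ne_zero hz hb) (div_ne_zero (h.angularSpeed_ne_zero hε hz hb)
    (pow_ne_zero 2 (h.hilbertFactor_pos hε hz).ne'))

end SphereImmersion

/-! ### The geodesic field and second Lie derivatives -/

/-- Cramer's rule: `A(X)` and `dA(X, ∂/∂t)` determine the base components, then `dA(X, ∂/∂xⁱ)` the
vertical one. Both systems are solvable because the contact volume is nonzero. -/
theorem IsReebAt.unique {F : Plane → Plane → ℝ} {z X Y : HPlane} (hX : IsReebAt F z X)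
    (hY : IsReebAt F z Y) (hl : liouvilleDensity F z ≠ 0) : X = Y := by
  have hA : ∀ x : HPlane, hilbertForm F z ![x] =
      x.1 0 * hilbertForm F z ![horiz 0] + x.1 1 * hilbertForm F z ![horiz 1] := by
    intro x
    conv_lhs => rw [hplane_eq x]
    simp [hilbertForm, vert]
  have hv : hilbertForm F z ![vert] = 0 := by simp [hilbertForm, vert]
  have hl' : liouvilleDensity F z =
      -(hilbertForm F z ![horiz 0]) * dHilbertForm F z ![vert, horiz 1]
        + hilbertForm F z ![horiz 1] * dHilbertForm F z ![vert, horiz 0] := by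
    rw [liouvilleDensity, wedge, hv]
    ring
  have a1 := hX.1.trans hY.1.symm
  have d := fun w => (hX.2 w).trans (hY.2 w).symm
  rw [hA X, hA Y] at a1
  simp only [twoForm_eq (dHilbertForm F z) X, twoForm_eq (dHilbertForm F z) Y] at d
  have dv := d vert
  have d0 := d (horiz 0)
  have d1 := d (horiz 1)
  simp [vert, horiz] at dv d0 d1
  change _ = _ at dv
  set α₀ := hilbertForm F z ![horiz 0]
  set α₁ := hilbertForm F z ![horiz 1]
  simp only [← show vert = ((0, 1) : HPlane) from rfl,
    ← show horiz 0 = ((EuclideanSpace.single 0 1, 0) : HPlane) from rfl,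
    ← show horiz 1 = ((EuclideanSpace.single 1 1, 0) : HPlane) from rfl] at dv d0 d1
  set β := dHilbertForm F z ![horiz 0, horiz 1]
  set β₀ := dHilbertForm F z ![vert, horiz 0]
  set β₁ := dHilbertForm F z ![vert, horiz 1]
  have e0 : X.1 0 = Y.1 0 := by
    refine sub_eq_zero.1 ((mul_eq_zero.1 ?_).resolve_right hl)
    rw [hl']
    linear_combination -β₁ * a1 - α₁ * dv
  have e1 : X.1 1 = Y.1 1 := by
    refine sub_eq_zero.1 ((mul_eq_zero.1 ?_).resolve_right hl)
    rw [hl']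
    linear_combination β₀ * a1 + α₀ * dv
  have e2 : X.2 = Y.2 := by
    refine sub_eq_zero.1 ((mul_eq_zero.1 ?_).resolve_right hl)
    rw [hl']
    rw [e1] at d0
    rw [e0] at d1
    linear_combination α₁ * d0 - α₀ * d1
  refine Prod.ext ?_ e2
  ext i
  fin_cases i
  · exact e0
  · exact e1

theorem SphereImmersion.geodesicField_spec {F : Plane → Plane → ℝ} {r : Plane → Space}
    {U : Set Plane} {ε : ℝ} {z : HPlane} (h : SphereImmersion r U) (hε : |ε| < 1)
    (hF : IsZermeloMetric F r ε U) (hz : z.1 ∈ U) :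
    fderiv ℝ r z.1 (geodesicField F z).1 = relVelocity r ε z + ε • rotGen (r z.1) ∧
      fderiv ℝ (relVelocity r ε) z (geodesicField F z) =
        -r z.1 + ε • rotGen (relVelocity r ε z) := by
  obtain ⟨X, h1, h2⟩ := h.exists_geodesicField hε hz
  have hX := h.isReebAt_of_fderiv hε hF hz h1 h2
  have e : geodesicField F z = X :=
    (Classical.epsilon_spec (p := IsReebAt F z) ⟨X, hX⟩ : IsReebAt F z (geodesicField F z)).unique hX
      (h.liouvilleDensity_ne_zero hε hF hz)
  rw [e]
  exact ⟨h1, h2⟩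

/-- Equality near `z`, not only at `z`, is what allows a second differentiation. -/
theorem SphereImmersion.lieDeriv_eventuallyEq {𝕜 : Type*} [RCLike 𝕜] {F : Plane → Plane → ℝ}
    {r : Plane → Space} {U : Set Plane} {ε : ℝ} {z : HPlane} (h : SphereImmersion r U)
    (hε : |ε| < 1) (hF : IsZermeloMetric F r ε U) (hz : z.1 ∈ U) {f : Plane → 𝕜} {g : Space → 𝕜}
    (hg : ContDiffAt ℝ 2 g (r z.1)) (hfg : f =ᶠ[nhds z.1] g ∘ r) :
    lieDeriv F (fun y : HPlane => f y.1) =ᶠ[nhds z] fun y =>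
      fderiv ℝ g (r y.1) (relVelocity r ε y + ε • rotGen (r y.1)) := by
  have h1 : ∀ᶠ y : HPlane in nhds z, f =ᶠ[nhds y.1] g ∘ r :=
    continuousAt_fst.eventually (eventually_eventually_nhds.2 hfg)
  have h2 : ∀ᶠ y : HPlane in nhds z, ContDiffAt ℝ 2 g (r y.1) :=
    (h.contDiffAt_base hz).continuousAt.eventually (hg.eventually (by simp))
  filter_upwards [h.eventually_mem hz, h1, h2] with y hy e1 e2
  have h3 : HasFDerivAt f ((fderiv ℝ g (r y.1)).comp (fderiv ℝ r y.1)) y.1 :=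
    ((e2.differentiableAt two_ne_zero).hasFDerivAt.comp y.1
      ((h.contDiffAt y.1 hy).differentiableAt two_ne_zero).hasFDerivAt).congr_of_eventuallyEq e1
  have h4 : HasFDerivAt (fun y : HPlane => f y.1) _ y := h3.comp y hasFDerivAt_fst
  rw [lieDeriv, h4.fderiv]
  simp [(h.geodesicField_spec hε hF hy).1]

/-- The acceleration is the derivative of `W + εRr` along `X`, namely `(-r + εRW) + εR(W + εRr)`:
the great circle term, a Coriolis term and a centrifugal term. -/
theorem SphereImmersion.lieDeriv_lieDeriv {𝕜 : Type*} [RCLike 𝕜] {F : Plane → Plane → ℝ}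
    {r : Plane → Space} {U : Set Plane} {ε : ℝ} {z : HPlane} (h : SphereImmersion r U)
    (hε : |ε| < 1) (hF : IsZermeloMetric F r ε U) (hz : z.1 ∈ U) {f : Plane → 𝕜} {g : Space → 𝕜}
    (hg : ContDiffAt ℝ 2 g (r z.1)) (hfg : f =ᶠ[nhds z.1] g ∘ r) :
    lieDeriv F (lieDeriv F (fun y : HPlane => f y.1)) z =
      fderiv ℝ (fderiv ℝ g) (r z.1) (relVelocity r ε z + ε • rotGen (r z.1))
          (relVelocity r ε z + ε • rotGen (r z.1))
        + fderiv ℝ g (r z.1) (-r z.1 + (2 * ε) • rotGen (relVelocity r ε z)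
            + ε ^ 2 • rotGen (rotGen (r z.1))) := by
  rw [lieDeriv, (h.lieDeriv_eventuallyEq hε hF hz hg hfg).fderiv_eq]
  have h1 := ((hg.fderiv_right (m := 1) (by norm_num)).differentiableAt
    one_ne_zero).hasFDerivAt.comp z (h.hasFDerivAt_base hz)
  have h2 := (h.differentiableAt_relVelocity hε hz).hasFDerivAt.add
    ((rotGen.hasFDerivAt.comp z (h.hasFDerivAt_base hz)).const_smul ε)
  have h3 := h1.clm_apply h2
  have h4 : fderiv ℝ (fun y : HPlane =>
      fderiv ℝ g (r y.1) (relVelocity r ε y + ε • rotGen (r y.1))) z = _ := h3.fderiv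
  obtain ⟨e1, e2⟩ := h.geodesicField_spec hε hF hz
  rw [h4]
  simp only [add_apply, ContinuousLinearMap.comp_apply, ContinuousLinearMap.flip_apply,
    ContinuousLinearMap.coe_fst', smul_apply, e1, e2, Function.comp_apply]
  rw [add_comm]
  congr 2
  rw [map_add, map_smul, smul_add, smul_smul, ← pow_two, two_mul, add_smul]
  abel

/-! ### Integration over the fibres -/

/-- The angle is the integral of the angular speed from an initial argument; the curve rotated back
by this angle has derivative zero. -/
theorem exists_angle_lift {c d c' d' : ℝ → ℝ} (hc : ∀ t, HasDerivAt c (c' t) t)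
    (hd : ∀ t, HasDerivAt d (d' t) t) (hc' : Continuous c') (hd' : Continuous d')
    (h1 : ∀ t, c t ^ 2 + d t ^ 2 = 1) :
    ∃ T : ℝ → ℝ, ∀ t, HasDerivAt T (c t * d' t - d t * c' t) t ∧
      c t = Real.cos (T t) ∧ d t = Real.sin (T t) := by
  have hcc : Continuous c := continuous_iff_continuousAt.2 fun t => (hc t).continuousAt
  have hdc : Continuous d := continuous_iff_continuousAt.2 fun t => (hd t).continuousAt
  set w : ℝ → ℝ := fun t => c t * d' t - d t * c' t with hw
  have hwc : Continuous w := by fun_prop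
  obtain ⟨T₀, hT0, hT0'⟩ : ∃ T₀, c 0 = Real.cos T₀ ∧ d 0 = Real.sin T₀ := by
    have hn : ‖(⟨c 0, d 0⟩ : ℂ)‖ = 1 := by
      rw [Complex.norm_def, Complex.normSq_mk, ← pow_two, ← pow_two, h1, Real.sqrt_one]
    have hne : (⟨c 0, d 0⟩ : ℂ) ≠ 0 := by
      rw [← norm_pos_iff, hn]; exact one_pos
    refine ⟨Complex.arg ⟨c 0, d 0⟩, ?_, ?_⟩
    · rw [Complex.cos_arg hne, hn, div_one]
    · rw [Complex.sin_arg, hn, div_one]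
  set T : ℝ → ℝ := fun t => T₀ + ∫ s in (0 : ℝ)..t, w s
  have hT : ∀ t, HasDerivAt T (w t) t := fun t =>
    (intervalIntegral.integral_hasDerivAt_right (hwc.intervalIntegrable _ _)
      (hwc.stronglyMeasurableAtFilter _ _) hwc.continuousAt).const_add T₀
  have hcd : ∀ t, c t * c' t + d t * d' t = 0 := by
    intro t
    have h2 := ((hc t).pow 2).add ((hd t).pow 2)
    have h3 := h2.unique (f := fun t => c t ^ 2 + d t ^ 2)
      (by simp only [h1]; exact hasDerivAt_const t 1)
    simp at h3
    linarith
  have e1 : ∀ t, c' t = -(d t * w t) := fun t => by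
    rw [hw]; linear_combination c t * hcd t - c' t * h1 t
  have e2 : ∀ t, d' t = c t * w t := fun t => by
    rw [hw]; linear_combination d t * hcd t - d' t * h1 t
  have hP : ∀ t, HasDerivAt (fun t => c t * Real.cos (T t) + d t * Real.sin (T t)) 0 t := by
    intro t
    have := ((hc t).mul (hT t).cos).add ((hd t).mul (hT t).sin)
    refine this.congr_deriv ?_
    rw [e1, e2]
    ring
  have hQ : ∀ t, HasDerivAt (fun t => d t * Real.cos (T t) - c t * Real.sin (T t)) 0 t := by
    intro t
    have := ((hd t).mul (hT t).cos).sub ((hc t).mul (hT t).sin)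
    refine this.congr_deriv ?_
    rw [e1, e2]
    ring
  have hT00 : T 0 = T₀ := by simp [T]
  refine ⟨T, fun t => ⟨hT t, ?_⟩⟩
  have p := is_const_of_deriv_eq_zero (fun t => (hP t).differentiableAt) (fun t => (hP t).deriv) t 0
  have q := is_const_of_deriv_eq_zero (fun t => (hQ t).differentiableAt) (fun t => (hQ t).deriv) t 0
  simp only [hT00, hT0, hT0'] at p q
  have s := Real.sin_sq_add_cos_sq (T t)
  have s0 := Real.sin_sq_add_cos_sq T₀
  constructor
  · linear_combination Real.cos (T t) * p - Real.sin (T t) * q - c t * s + Real.cos (T t) * s0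
  · linear_combination Real.sin (T t) * p + Real.cos (T t) * q - d t * s + Real.sin (T t) * s0

/-- Rolle's theorem excludes winding number zero. Its actual value is irrelevant, since it cancels
in the normalized average. -/
theorem exists_winding {T w : ℝ → ℝ} (hT : ∀ t, HasDerivAt T (w t) t) (hw : ∀ t, w t ≠ 0)
    (hc : Real.cos (T (2 * π)) = Real.cos (T 0)) (hs : Real.sin (T (2 * π)) = Real.sin (T 0)) :
    ∃ k : ℤ, k ≠ 0 ∧ T (2 * π) = T 0 + k • (2 * π) := by
  obtain ⟨k, hk⟩ := Real.Angle.angle_eq_iff_two_pi_dvd_sub.1 (Real.Angle.cos_sin_inj hc hs)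
  refine ⟨k, ?_, by rw [zsmul_eq_mul]; linarith⟩
  rintro rfl
  obtain ⟨t, -, ht⟩ := exists_hasDerivAt_eq_zero (f := T) (f' := w) two_pi_pos
    (fun t _ => (hT t).continuousAt.continuousWithinAt) (by simp at hk; linarith) (fun t _ => hT t)
  exact hw t ht

theorem integral_comp_winding {E : Type*} [NormedAddCommGroup E] [NormedSpace ℝ E]
    [CompleteSpace E] {T w : ℝ → ℝ} (hT : ∀ t, HasDerivAt T (w t) t) (hw : Continuous w) {k : ℤ}
    (hk : T (2 * π) = T 0 + k • (2 * π)) {G : ℝ → E} (hG : Continuous G)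
    (hp : Function.Periodic G (2 * π)) :
    ∫ t in (0 : ℝ)..(2 * π), w t • G (T t) = k • ∫ τ in (0 : ℝ)..(2 * π), G τ := by
  rw [show (∫ t in (0 : ℝ)..(2 * π), w t • G (T t)) = ∫ t in (0 : ℝ)..(2 * π), w t • (G ∘ T) t
    from rfl, intervalIntegral.integral_deriv_smul_comp (fun t _ => hT t) hw.continuousOn hG, hk,
    hp.intervalIntegral_add_zsmul_eq k (T 0) (fun a b => hG.intervalIntegrable a b),
    hp.intervalIntegral_add_eq (T 0) 0, zero_add]

/-- The Finsler-Laplace operator as an average over a circle that parametrizes the fibre. -/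
theorem planeLaplacian_eq_circle_average {𝕜 : Type*} [RCLike 𝕜] {F : Plane → Plane → ℝ}
    {f : Plane → 𝕜} {x : Plane} {T w m : ℝ → ℝ} {G : ℝ → 𝕜} {C : ℝ}
    (hT : ∀ t, HasDerivAt T (w t) t) (hwc : Continuous w) (hw : ∀ t, w t ≠ 0)
    (hc : Real.cos (T (2 * π)) = Real.cos (T 0)) (hs : Real.sin (T (2 * π)) = Real.sin (T 0))
    (hm : Continuous m) (hmp : Function.Periodic m (2 * π))
    (hG : Continuous G) (hGp : Function.Periodic G (2 * π)) (hC : C ≠ 0)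
    (hl : ∀ t, liouvilleDensity F (x, t) = C * (w t * m (T t)))
    (hL : ∀ t, lieDeriv F (lieDeriv F (fun z : HPlane => f z.1)) (x, t) = G (T t)) :
    IntervalIntegrable (laplaceIntegrand F f x) volume 0 (2 * π) ∧
      planeLaplacian F f x = (2 / ∫ τ in (0 : ℝ)..(2 * π), m τ) •
        ∫ τ in (0 : ℝ)..(2 * π), m τ • G τ := by
  obtain ⟨k, hk0, hk⟩ := exists_winding hT hw hc hs
  have hk0' : (k : ℝ) ≠ 0 := Int.cast_ne_zero.2 hk0
  have hTc : Continuous T := continuous_iff_continuousAt.2 fun t => (hT t).continuousAt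
  set I := ∫ τ in (0 : ℝ)..(2 * π), m τ
  have hv : volumeDensity F x = C * k * I / (2 * π) := by
    have := integral_comp_winding hT hwc hk hm hmp
    simp only [smul_eq_mul, zsmul_eq_mul] at this
    rw [volumeDensity]
    simp only [hl]
    rw [intervalIntegral.integral_const_mul, this]
    ring
  -- The factor `C` cancels against the volume density; `k` remains and cancels against the winding
  -- of the integral. For `I = 0` both sides are zero by the convention on division.
  have he : laplaceIntegrand F f x = fun t => (2 * π / (k * I)) • (w t • (m (T t) • G (T t))) := by
    ext t
    rw [laplaceIntegrand, angleForm_vert, hL, hl, hv, smul_smul, smul_smul]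
    congr 1
    have := pi_ne_zero
    by_cases hI : I = 0
    · simp [hI]
    · field_simp
  refine ⟨?_, ?_⟩
  · rw [he]
    exact Continuous.intervalIntegrable (by fun_prop) _ _
  · have hmG : Function.Periodic (fun τ => m τ • G τ) (2 * π) := fun τ => by
      simp only [hmp τ, hGp τ]
    rw [planeLaplacian, he, intervalIntegral.integral_smul,
      integral_comp_winding hT hwc hk (G := fun τ => m τ • G τ) (hm.smul hG) hmG, ← Int.cast_smul_eq_zsmul ℝ, smul_smul,
      smul_smul]
    congr 1
    have := pi_ne_zero
    by_cases hI : I = 0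
    · simp [hI]
    · field_simp

/-! ### Trigonometric integrals -/

section Integrals

variable {a : ℝ}

theorem one_add_mul_cos_pos (ha : |a| < 1) (τ : ℝ) : 0 < 1 + a * Real.cos τ := by
  have h1 := abs_le.1 (abs_mul a (Real.cos τ) ▸ mul_le_of_le_one_right (abs_nonneg a)
    (Real.abs_cos_le_one τ))
  linarith [h1.1]

theorem hasDerivAt_one_add_mul_cos (a τ : ℝ) :
    HasDerivAt (fun τ => 1 + a * Real.cos τ) (-(a * Real.sin τ)) τ := by
  have := ((Real.hasDerivAt_cos τ).const_mul a).const_add 1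
  simpa using this

theorem continuous_div_one_add_mul_cos (ha : |a| < 1) {p : ℝ → ℝ} (hp : Continuous p) (n : ℕ) :
    Continuous fun τ => p τ / (1 + a * Real.cos τ) ^ n :=
  hp.div (by fun_prop) fun τ => pow_ne_zero n (one_add_mul_cos_pos ha τ).ne'

/-- With `a = 2b / (1 + b²)` and `|b| < 1`, the function `(τ - 2 arg(1 + b e^{iτ})) / r` is an
antiderivative. It is smooth on the whole line, unlike the one from the half-angle substitution. -/
theorem integral_inv_one_add_mul_cos (ha : |a| < 1) :
    ∫ τ in (0 : ℝ)..(2 * π), 1 / (1 + a * Real.cos τ) = 2 * π / √(1 - a ^ 2) := by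
  have ha2 : a ^ 2 < 1 := (sq_lt_one_iff_abs_lt_one a).2 ha
  set r := √(1 - a ^ 2) with hr
  have hr0 : 0 < r := Real.sqrt_pos.2 (by linarith)
  have hr2 : r ^ 2 = 1 - a ^ 2 := Real.sq_sqrt (by linarith)
  set b := a / (1 + r) with hb
  have hab : a = b * (1 + r) := by rw [hb]; field_simp
  have hb1 : |b| < 1 := by
    rw [hb, abs_div, abs_of_pos (by linarith : 0 < 1 + r), div_lt_one (by linarith)]
    linarith
  have hbr : b ^ 2 * (1 + r) = 1 - r := by
    have : (1 + r) * (b ^ 2 * (1 + r) - (1 - r)) = 0 := by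
      have : a ^ 2 = b ^ 2 * (1 + r) ^ 2 := by rw [hab]; ring
      linear_combination hr2 - this
    have := (mul_eq_zero.1 this).resolve_left (by linarith)
    linarith
  clear_value b
  have hd : ∀ τ, HasDerivAt (fun τ => (τ - 2 * Real.arctan (b * Real.sin τ / (1 + b * Real.cos τ)))
      / r) (1 / (1 + a * Real.cos τ)) τ := by
    intro τ
    have hp := one_add_mul_cos_pos hb1 τ
    have hpa := one_add_mul_cos_pos ha τ
    have h1 := (((Real.hasDerivAt_sin τ).const_mul b).div (hasDerivAt_one_add_mul_cos b τ)
      hp.ne').arctan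
    have h2 := ((hasDerivAt_id τ).sub (h1.const_mul 2)).div_const r
    refine h2.congr_deriv ?_
    have hs := Real.sin_sq_add_cos_sq τ
    have hq : 0 < (1 + b * Real.cos τ) ^ 2 + (b * Real.sin τ) ^ 2 := by positivity
    have e1 : 1 / (1 + (b * Real.sin τ / (1 + b * Real.cos τ)) ^ 2) *
        ((b * Real.cos τ * (1 + b * Real.cos τ) - b * Real.sin τ * -(b * Real.sin τ)) /
          (1 + b * Real.cos τ) ^ 2) =
        (b * Real.cos τ + b ^ 2) / ((1 + b * Real.cos τ) ^ 2 + (b * Real.sin τ) ^ 2) := by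
      rw [show b * Real.cos τ * (1 + b * Real.cos τ) - b * Real.sin τ * -(b * Real.sin τ) =
          b * Real.cos τ + b ^ 2 by linear_combination b ^ 2 * hs,
        show 1 + (b * Real.sin τ / (1 + b * Real.cos τ)) ^ 2 =
          ((1 + b * Real.cos τ) ^ 2 + (b * Real.sin τ) ^ 2) / (1 + b * Real.cos τ) ^ 2 by
            field_simp]
      field_simp
    have e2 : (1 + b * Real.cos τ) ^ 2 + (b * Real.sin τ) ^ 2 =
        2 / (1 + r) * (1 + a * Real.cos τ) := by
      rw [hab]
      field_simp
      linear_combination (1 + r) * b ^ 2 * hs + hbr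
    simp only [Pi.div_apply]
    rw [e1, e2]
    have hP : 1 + a * Real.cos τ = 1 + b * (1 + r) * Real.cos τ := by rw [← hab]
    have hne := hpa.ne'
    generalize 1 + a * Real.cos τ = P at hP hne ⊢
    field_simp
    linear_combination hP - hbr
  rw [intervalIntegral.integral_eq_sub_of_hasDerivAt (fun τ _ => hd τ)]
  · simp
  · have := continuous_div_one_add_mul_cos ha (p := fun _ => 1) continuous_const 1
    simp only [pow_one] at this
    exact this.intervalIntegrable _ _

theorem integral_inv_one_add_mul_cos_sq (ha : |a| < 1) :
    ∫ τ in (0 : ℝ)..(2 * π), 1 / (1 + a * Real.cos τ) ^ 2 = 2 * π / √(1 - a ^ 2) ^ 3 := by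
  have ha2 : a ^ 2 < 1 := (sq_lt_one_iff_abs_lt_one a).2 ha
  have h1 := integral_inv_one_add_mul_cos ha
  set r := √(1 - a ^ 2) with hr
  have hr0 : 0 < r := Real.sqrt_pos.2 (by linarith)
  have hr2 : r ^ 2 = 1 - a ^ 2 := Real.sq_sqrt (by linarith)
  have c1 : Continuous fun τ => 1 / (1 + a * Real.cos τ) := by
    simpa using continuous_div_one_add_mul_cos ha (p := fun _ => 1) continuous_const 1
  have c2 := continuous_div_one_add_mul_cos ha (p := fun _ => 1) continuous_const 2
  -- A periodic function, so its derivative integrates to zero and links the integral to the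
  -- previous one.
  have hd : ∀ τ, HasDerivAt (fun τ => a * Real.sin τ / (1 + a * Real.cos τ))
      (1 / (1 + a * Real.cos τ) - r ^ 2 * (1 / (1 + a * Real.cos τ) ^ 2)) τ := by
    intro τ
    have hpa := one_add_mul_cos_pos ha τ
    refine (((Real.hasDerivAt_sin τ).const_mul a).div (hasDerivAt_one_add_mul_cos a τ)
      hpa.ne').congr_deriv ?_
    rw [hr2]
    field_simp
    linear_combination a ^ 2 * Real.sin_sq_add_cos_sq τ
  have h2 := intervalIntegral.integral_eq_sub_of_hasDerivAt (a := 0) (b := 2 * π)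
    (fun τ _ => hd τ) ((c1.sub (c2.const_mul (r ^ 2))).intervalIntegrable _ _)
  rw [intervalIntegral.integral_sub (c1.intervalIntegrable _ _)
    ((c2.const_mul (r ^ 2)).intervalIntegrable _ _), intervalIntegral.integral_const_mul, h1] at h2
  simp only [mul_zero, Real.sin_two_pi, Real.sin_zero, zero_div, sub_zero] at h2
  rw [eq_div_iff (by positivity)]
  field_simp at h2
  linarith

theorem integral_sin_sq_div_one_add_mul_cos_sq (ha : |a| < 1) :
    ∫ τ in (0 : ℝ)..(2 * π), Real.sin τ ^ 2 / (1 + a * Real.cos τ) ^ 2 =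
      2 * π / (√(1 - a ^ 2) * (1 + √(1 - a ^ 2))) := by
  by_cases ha0 : a = 0
  · subst ha0
    simp [integral_sin_sq]
    ring
  have ha2 : a ^ 2 < 1 := (sq_lt_one_iff_abs_lt_one a).2 ha
  have h1 := integral_inv_one_add_mul_cos ha
  set r := √(1 - a ^ 2) with hr
  have hr0 : 0 < r := Real.sqrt_pos.2 (by linarith)
  have hr2 : r ^ 2 = 1 - a ^ 2 := Real.sq_sqrt (by linarith)
  have c1 : Continuous fun τ => 1 / (1 + a * Real.cos τ) := by
    simpa using continuous_div_one_add_mul_cos ha (p := fun _ => 1) continuous_const 1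
  have c2 := continuous_div_one_add_mul_cos ha (p := fun τ => Real.sin τ ^ 2) (by fun_prop) 2
  -- The same derivative, written differently, gives `a² K = 2π (1 / r - 1)`. Recovering `K`
  -- requires `a ≠ 0`, whence the separate case.
  have hd : ∀ τ, HasDerivAt (fun τ => a * Real.sin τ / (1 + a * Real.cos τ))
      (1 - 1 / (1 + a * Real.cos τ) +
        a ^ 2 * (Real.sin τ ^ 2 / (1 + a * Real.cos τ) ^ 2)) τ := by
    intro τ
    have hpa := one_add_mul_cos_pos ha τ
    refine (((Real.hasDerivAt_sin τ).const_mul a).div (hasDerivAt_one_add_mul_cos a τ)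
      hpa.ne').congr_deriv ?_
    field_simp
    ring
  have c3 : Continuous fun τ => 1 - 1 / (1 + a * Real.cos τ) := continuous_const.sub c1
  have h2 := intervalIntegral.integral_eq_sub_of_hasDerivAt (a := 0) (b := 2 * π)
    (fun τ _ => hd τ) ((c3.add (c2.const_mul (a ^ 2))).intervalIntegrable _ _)
  rw [intervalIntegral.integral_add (c3.intervalIntegrable _ _)
    ((c2.const_mul (a ^ 2)).intervalIntegrable _ _), intervalIntegral.integral_const_mul,
    intervalIntegral.integral_sub (by simp) (c1.intervalIntegrable _ _), h1] at h2
  simp at h2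
  rw [eq_div_iff (by positivity)]
  field_simp at h2
  set K := ∫ τ in (0 : ℝ)..(2 * π), Real.sin τ ^ 2 / (1 + a * Real.cos τ) ^ 2
  have h3 : a ^ 2 = (1 - r) * (1 + r) := by linear_combination hr2
  have h4 : 1 - r ≠ 0 := by
    intro h
    rw [h, zero_mul] at h3
    exact ha0 (by simpa using h3)
  refine mul_left_cancel₀ h4 ?_
  rw [h3] at h2
  linear_combination h2

end Integrals

/-! ### The sphere in a chart -/

instance fact_finrank_space : Fact (Module.finrank ℝ Space = 2 + 1) :=
  ⟨finrank_euclideanSpace_fin⟩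

theorem mdifferentiableAt_coe_sphere (q : S2) :
    MDifferentiableAt (𝓡 2) 𝓘(ℝ, Space) ((↑) : S2 → Space) q :=
  (contMDiff_coe_sphere (m := 1)).mdifferentiableAt one_ne_zero

/-- The differential of the inclusion of the sphere into space. -/
noncomputable def sphereIncl (q : S2) : Plane →L[ℝ] Space :=
  mfderiv (𝓡 2) 𝓘(ℝ, Space) ((↑) : S2 → Space) q

theorem sphereIncl_injective (q : S2) : Function.Injective (sphereIncl q) := by
  have h := injective_mvfderiv_subtypeVal_sphere (n := 2) q
  exact h

theorem sphereIncl_rotationField (q : S2) :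
    sphereIncl q (rotationField q) = rotGen (q : Space) := by
  have hsm : ContMDiff 𝓘(ℝ, ℝ) (𝓡 2) 1 (fun t => rotation t q) := by
    have h : ContMDiff 𝓘(ℝ, ℝ) 𝓘(ℝ, Space) 1 (fun t => (rotation t q : Space)) := by
      rw [contMDiff_iff_contDiff]
      refine contDiff_euclidean.2 fun i => ?_
      fin_cases i <;> simp [rotation] <;> fun_prop
    exact h.codRestrict_sphere fun t => (rotation t q).2
  have h0 : rotation 0 q = q := by
    apply Subtype.ext
    ext i
    fin_cases i <;> simp [rotation]
  have h1 := mfderiv_comp (0 : ℝ) (g := ((↑) : S2 → Space)) (f := fun t => rotation t q)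
    (I := 𝓘(ℝ, ℝ)) (I' := 𝓡 2) (I'' := 𝓘(ℝ, Space))
    (mdifferentiableAt_coe_sphere _) (hsm.mdifferentiableAt one_ne_zero)
  have h2 : HasDerivAt (fun t => (rotation t q : Space)) (rotGen q) 0 := by
    have hc : ContDiff ℝ 1 (fun t => (rotation t q : Space)) := by
      refine contDiff_euclidean.2 fun i => ?_
      fin_cases i <;> simp [rotation] <;> fun_prop
    have h' := (hc.differentiable one_ne_zero 0).hasDerivAt
    have : deriv (fun t => (rotation t q : Space)) 0 = rotGen q := by
      have e : ∀ i, (deriv (fun t => (rotation t q : Space)) 0) i =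
          deriv (fun s => (rotation s q : Space) i) 0 := fun i =>
        (((EuclideanSpace.proj i : Space →L[ℝ] ℝ).hasFDerivAt.comp_hasDerivAt 0 h').deriv).symm
      ext i
      rw [e]
      fin_cases i
      · simp [rotation, rotGen_apply]
      · simp [rotation, rotGen_apply]
      · simp [rotation, rotGen_apply]
    rwa [this] at h'
  rw [mfderiv_eq_fderiv] at h1
  have h3 := DFunLike.congr_fun h1 (1 : ℝ)
  rw [show fderiv ℝ (((↑) : S2 → Space) ∘ fun t => rotation t q) 0 = _ from h2.hasFDerivAt.fderiv]
    at h3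
  have h4 : sphereIncl (rotation 0 q) (rotationField q) = rotGen q := by
    refine Eq.trans h3.symm ?_
    exact one_smul ℝ (rotGen (q : Space))
  rwa [h0] at h4

variable {e : OpenPartialHomeomorph S2 Plane}

theorem fderiv_chart_symm (he : e ∈ IsManifold.maximalAtlas (𝓡 2) ∞ S2) {x : Plane}
    (hx : x ∈ e.target) (v : Plane) :
    fderiv ℝ (fun y => (e.symm y : Space)) x v =
      sphereIncl (e.symm x) (mfderiv (𝓡 2) (𝓡 2) e.symm x v) := by
  have hs : MDifferentiableAt (𝓡 2) (𝓡 2) e.symm x :=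
    ((contMDiffOn_symm_of_mem_maximalAtlas he).contMDiffAt
      (e.open_target.mem_nhds hx)).mdifferentiableAt (by simp)
  have h1 := mfderiv_comp x (g := ((↑) : S2 → Space)) (f := e.symm)
    (I := 𝓡 2) (I' := 𝓡 2) (I'' := 𝓘(ℝ, Space)) (mdifferentiableAt_coe_sphere _) hs
  rw [mfderiv_eq_fderiv] at h1
  exact DFunLike.congr_fun h1 v

theorem mfderiv_chart_symm_injective (he : e ∈ IsManifold.maximalAtlas (𝓡 2) ∞ S2) {x : Plane}
    (hx : x ∈ e.target) : Function.Injective (mfderiv (𝓡 2) (𝓡 2) e.symm x) := by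
  have hs : MDifferentiableAt (𝓡 2) (𝓡 2) e.symm x :=
    ((contMDiffOn_symm_of_mem_maximalAtlas he).contMDiffAt
      (e.open_target.mem_nhds hx)).mdifferentiableAt (by simp)
  have hm : MDifferentiableAt (𝓡 2) (𝓡 2) e (e.symm x) :=
    ((contMDiffOn_of_mem_maximalAtlas he).contMDiffAt
      (e.open_source.mem_nhds (e.map_target hx))).mdifferentiableAt (by simp)
  have h1 := mfderiv_comp x (g := e) (f := e.symm) (I := 𝓡 2) (I' := 𝓡 2) (I'' := 𝓡 2) hm hs
  have h2 : e ∘ e.symm =ᶠ[nhds x] id := by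
    filter_upwards [e.open_target.mem_nhds hx] with y hy
    exact e.right_inv hy
  rw [h2.mfderiv_eq, mfderiv_id] at h1
  intro u w huw
  have hu := DFunLike.congr_fun h1 u
  have hw := DFunLike.congr_fun h1 w
  have := congrArg (mfderiv (𝓡 2) (𝓡 2) e (e.symm x)) huw
  exact hu.trans (this.trans hw.symm)

theorem sphereImmersion_chart (he : e ∈ IsManifold.maximalAtlas (𝓡 2) ∞ S2) :
    SphereImmersion (fun y => (e.symm y : Space)) e.target where
  isOpen := e.open_target
  contDiffAt x hx := by
    have hs : ContMDiffAt (𝓡 2) (𝓡 2) 2 e.symm x :=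
      ((contMDiffOn_symm_of_mem_maximalAtlas he).contMDiffAt
        (e.open_target.mem_nhds hx)).of_le (WithTop.coe_le_coe.2 le_top)
    exact ((contMDiff_coe_sphere (m := 2)).contMDiffAt.comp x hs).contDiffAt
  norm_eq x _ := norm_eq_of_mem_sphere (e.symm x)
  injective x hx u w h := by
    rw [fderiv_chart_symm he hx, fderiv_chart_symm he hx] at h
    exact mfderiv_chart_symm_injective he hx (sphereIncl_injective _ h)

theorem isZermeloMetric_chart {ε : ℝ} (hε : |ε| < 1)
    (he : e ∈ IsManifold.maximalAtlas (𝓡 2) ∞ S2) :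
    IsZermeloMetric (localMetric e (katokZillerS2 ε)) (fun y => (e.symm y : Space)) ε
      e.target := by
  intro x hx v hv
  have hV := norm_smul_rotGen_lt hε (norm_eq_of_mem_sphere (e.symm x))
  rw [← sphereIncl_rotationField] at hV
  have hξ : (mfderiv (𝓡 2) (𝓡 2) e.symm x v : Plane) ≠ 0 := fun h =>
    hv (mfderiv_chart_symm_injective he hx (h.trans (map_zero _).symm))
  rw [fderiv_chart_symm he hx, ← sphereIncl_rotationField]
  exact katokZillerNorm_eq_zermeloNorm (sphereIncl (e.symm x)) (sphereIncl_injective _) hV hξ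

/-- A function of class `C²` near a point of the sphere extends to a neighbourhood in space. -/
theorem exists_extension {𝕜 : Type*} [RCLike 𝕜] {f : S2 → 𝕜} {p : S2}
    (hf : ContMDiffAt (𝓡 2) 𝓘(ℝ, 𝕜) 2 f p) :
    ∃ g : Space → 𝕜, ContDiffAt ℝ 2 g p ∧ ∀ᶠ q : S2 in nhds p, f q = g q := by
  have h1 : ContDiffAt ℝ 2 (f ∘ (chartAt Plane p).symm) (chartAt Plane p p) := by
    have hs : ContMDiffAt (𝓡 2) (𝓡 2) 2 (chartAt Plane p).symm (chartAt Plane p p) :=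
      contMDiffOn_chart_symm.contMDiffAt
        ((chartAt Plane p).open_target.mem_nhds (mem_chart_target Plane p))
    exact (ContMDiffAt.comp_of_eq hf hs
      ((chartAt Plane p).left_inv (mem_chart_source Plane p))).contDiffAt
  set v : Space := ((-p : S2) : Space) with hv
  let B := (OrthonormalBasis.fromOrthogonalSpanSingleton (𝕜 := ℝ) 2
    (ne_zero_of_mem_unit_sphere (-p))).repr
  -- The chart at `p` is stereographic projection from `-p`, whose formula makes sense and is smooth
  -- in space off the plane `⟨v, y⟩ = 1`. Composing with it extends `f`.
  have h2 : ∀ q : S2, chartAt Plane p q = B (stereoToFun v q) := fun q => rfl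
  have h3 : ContDiffAt ℝ 2 (fun y : Space => B (stereoToFun v y)) p := by
    refine B.contDiff.contDiffAt.comp _ (contDiffOn_stereoToFun.contDiffAt ?_)
    refine IsOpen.mem_nhds (isOpen_ne_fun (by fun_prop) continuous_const) ?_
    simp [hv]
    norm_num
  refine ⟨fun y => (f ∘ (chartAt Plane p).symm) (B (stereoToFun v y)), ?_, ?_⟩
  · refine ContDiffAt.comp (g := f ∘ (chartAt Plane p).symm)
      (f := fun y : Space => B (stereoToFun v y)) (p : Space) ?_ h3
    rw [← h2]
    exact h1
  · filter_upwards [(chartAt Plane p).open_source.mem_nhds (mem_chart_source Plane p)] with q hq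
    rw [← h2, Function.comp_apply, (chartAt Plane p).left_inv hq]

/-! ### Second derivatives along curves -/

section Curve

variable {𝕜 : Type*} [RCLike 𝕜] {E : Type*} [NormedAddCommGroup E] [NormedSpace ℝ E]
  {g : E → 𝕜} {γ γ' : ℝ → E} {γ'' : E} {h : ℝ → 𝕜} {t₀ : ℝ}

theorem deriv_eventuallyEq_of_curve (hg : ContDiffAt ℝ 2 g (γ t₀))
    (hγ : ∀ t, HasDerivAt γ (γ' t) t) (hh : h =ᶠ[nhds t₀] g ∘ γ) :
    deriv h =ᶠ[nhds t₀] fun t => fderiv ℝ g (γ t) (γ' t) := by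
  have h1 : ∀ᶠ t in nhds t₀, ContDiffAt ℝ 2 g (γ t) :=
    (hγ t₀).continuousAt.eventually (hg.eventually (by simp))
  filter_upwards [h1, eventually_eventually_nhds.2 hh] with t e1 e2
  rw [Filter.EventuallyEq.deriv_eq e2]
  exact ((e1.differentiableAt two_ne_zero).hasFDerivAt.comp_hasDerivAt t (hγ t)).deriv

theorem iteratedDeriv_two_of_curve (hg : ContDiffAt ℝ 2 g (γ t₀))
    (hγ : ∀ t, HasDerivAt γ (γ' t) t) (hγ' : HasDerivAt γ' γ'' t₀) (hh : h =ᶠ[nhds t₀] g ∘ γ) :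
    iteratedDeriv 2 h t₀ =
      fderiv ℝ (fderiv ℝ g) (γ t₀) (γ' t₀) (γ' t₀) + fderiv ℝ g (γ t₀) γ'' := by
  rw [iteratedDeriv_succ, iteratedDeriv_one,
    (deriv_eventuallyEq_of_curve hg hγ hh).deriv_eq]
  have h1 := (((hg.fderiv_right (m := 1) (by norm_num)).differentiableAt
    one_ne_zero).hasFDerivAt.comp_hasDerivAt t₀ (hγ t₀)).clm_apply hγ'
  exact h1.deriv

end Curve

/-! ### The spherical frame -/

/-- The unit tangent vector `(1 / sin φ) ∂/∂θ`. -/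
noncomputable def sphericalEast (θ : ℝ) : Space := !₂[-Real.sin θ, Real.cos θ, 0]

/-- The unit tangent vector `∂/∂φ`. -/
noncomputable def sphericalSouth (φ θ : ℝ) : Space :=
  !₂[Real.cos φ * Real.cos θ, Real.cos φ * Real.sin θ, -Real.sin φ]

theorem spherical_coe (φ θ : ℝ) : (spherical φ θ : Space) =
    !₂[Real.sin φ * Real.cos θ, Real.sin φ * Real.sin θ, Real.cos φ] := rfl

theorem hasDerivAt_space {γ : ℝ → Space} {v : Space} {t : ℝ}
    (h : ∀ i, HasDerivAt (fun s => γ s i) (v i) t) : HasDerivAt γ v t :=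
  (EuclideanSpace.equiv (Fin 3) ℝ).symm.hasFDerivAt.comp_hasDerivAt t (hasDerivAt_pi.2 h)

theorem hasDerivAt_spherical_colatitude (φ θ : ℝ) :
    HasDerivAt (fun φ' => (spherical φ' θ : Space)) (sphericalSouth φ θ) φ := by
  refine hasDerivAt_space fun i => ?_
  fin_cases i
  · exact (Real.hasDerivAt_sin φ).mul_const _
  · exact (Real.hasDerivAt_sin φ).mul_const _
  · exact Real.hasDerivAt_cos φ

theorem hasDerivAt_sphericalSouth (φ θ : ℝ) :
    HasDerivAt (fun φ' => sphericalSouth φ' θ) (-(spherical φ θ : Space)) φ := by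
  refine hasDerivAt_space fun i => ?_
  fin_cases i
  · exact ((Real.hasDerivAt_cos φ).mul_const (Real.cos θ)).congr_deriv (by simp [spherical_coe])
  · exact ((Real.hasDerivAt_cos φ).mul_const (Real.sin θ)).congr_deriv (by simp [spherical_coe])
  · exact (Real.hasDerivAt_sin φ).neg

theorem hasDerivAt_spherical_longitude (φ θ : ℝ) :
    HasDerivAt (fun θ' => (spherical φ θ' : Space)) (Real.sin φ • sphericalEast θ) θ := by
  refine hasDerivAt_space fun i => ?_
  fin_cases i
  · exact (Real.hasDerivAt_cos θ).const_mul _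
  · exact (Real.hasDerivAt_sin θ).const_mul _
  · exact (hasDerivAt_const θ (Real.cos φ)).congr_deriv (by simp [sphericalEast])

theorem hasDerivAt_sphericalEast (φ θ : ℝ) :
    HasDerivAt (fun θ' => Real.sin φ • sphericalEast θ')
      (Real.sin φ • rotGen (sphericalEast θ)) θ := by
  refine HasDerivAt.const_smul (Real.sin φ) (hasDerivAt_space fun i => ?_)
  fin_cases i
  · exact (Real.hasDerivAt_sin θ).neg
  · exact Real.hasDerivAt_cos θ
  · exact hasDerivAt_const θ (0 : ℝ)

theorem rotGen_spherical (φ θ : ℝ) :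
    rotGen (spherical φ θ) = Real.sin φ • sphericalEast θ := by
  ext i
  fin_cases i <;> simp [rotGen_apply, spherical_coe, sphericalEast]

theorem exists_spherical_frame (φ θ : ℝ) : ∃ b : OrthonormalBasis (Fin 3) ℝ Space,
    b 0 = spherical φ θ ∧ b 1 = sphericalEast θ ∧ b 2 = sphericalSouth φ θ := by
  let v : Fin 3 → Space := ![spherical φ θ, sphericalEast θ, sphericalSouth φ θ]
  have e1 := Real.sin_sq_add_cos_sq φ
  have e2 := Real.sin_sq_add_cos_sq θ
  have hv : Orthonormal ℝ v := by
    rw [orthonormal_iff_ite]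
    intro i j
    rw [space_inner]
    fin_cases i <;> fin_cases j <;>
      simp [v, spherical_coe, sphericalEast, sphericalSouth]
    · linear_combination Real.sin φ ^ 2 * e2 + e1
    · ring
    · linear_combination Real.sin φ * Real.cos φ * e2
    · ring
    · linear_combination e2
    · ring
    · linear_combination Real.sin φ * Real.cos φ * e2
    · ring
    · linear_combination Real.cos φ ^ 2 * e2 + e1
  obtain ⟨b, hb⟩ := Orthonormal.exists_orthonormalBasis_extension_of_card_eq (v := v)
    (s := Set.univ) (𝕜 := ℝ) (by simp) (hv.comp _ Subtype.val_injective)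
  exact ⟨b, hb 0 trivial, hb 1 trivial, hb 2 trivial⟩

/-- The acceleration of a unit speed geodesic, in terms of the second derivatives of the spherical
coordinates and of the Christoffel symbols. -/
theorem geodesic_acceleration (ε θ τ : ℝ) {φ : ℝ} (hs : Real.sin φ ≠ 0) :
    -(spherical φ θ : Space)
        + (2 * ε) • rotGen (Real.cos τ • sphericalEast θ + Real.sin τ • sphericalSouth φ θ)
        + ε ^ 2 • rotGen (rotGen (spherical φ θ)) =
      Real.sin τ ^ 2 • -(spherical φ θ : Space)
        + (Real.cos τ / Real.sin φ + ε) ^ 2 • Real.sin φ • rotGen (sphericalEast θ)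
        + (Real.cos φ / Real.sin φ * Real.cos τ ^ 2) • sphericalSouth φ θ
        + (2 * ε * Real.cos φ * Real.sin τ) • sphericalEast θ := by
  have e1 := Real.sin_sq_add_cos_sq φ
  have e2 := Real.sin_sq_add_cos_sq τ
  rw [rotGen_spherical]
  ext i
  fin_cases i <;> simp [rotGen_apply, spherical_coe, sphericalEast, sphericalSouth] <;>
    field_simp
  · linear_combination Real.cos θ * (Real.sin φ ^ 2 * e2 - Real.cos τ ^ 2 * e1)
  · linear_combination Real.sin θ * (Real.sin φ ^ 2 * e2 - Real.cos τ ^ 2 * e1)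
  · linear_combination Real.cos φ * e2

theorem integral_eq_zero_of_antisymm {h : ℝ → ℝ} (hh : ∀ τ, h (2 * π - τ) = -h τ) :
    ∫ τ in (0 : ℝ)..(2 * π), h τ = 0 := by
  have h1 := intervalIntegral.integral_comp_sub_left (a := 0) (b := 2 * π) h (2 * π)
  simp only [hh, intervalIntegral.integral_neg, sub_zero, sub_self] at h1
  linarith

/-- The circle average of the second derivatives along the geodesics of `F_ε`. -/
theorem circle_average {𝕜 : Type*} [RCLike 𝕜] {ε s κ : ℝ} (hs : s ≠ 0) (ha : |ε * s| < 1)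
    (x₁ x₂ x₃ x₄ x₅ : 𝕜) :
    (2 / ∫ τ in (0 : ℝ)..(2 * π), 1 / (1 + (ε * s) * Real.cos τ) ^ 2) •
        ∫ τ in (0 : ℝ)..(2 * π), (1 / (1 + (ε * s) * Real.cos τ) ^ 2) •
          (Real.sin τ ^ 2 • x₁ + (Real.cos τ / s + ε) ^ 2 • x₂ + (κ * Real.cos τ ^ 2) • x₃
            + Real.sin τ • x₄ + (Real.sin τ * (Real.cos τ / s + ε)) • x₅) =
      (2 / (1 + √(1 - ε ^ 2 * s ^ 2)) : ℝ) •
        ((1 / s ^ 2 * (1 - ε ^ 2 * s ^ 2) ^ (3 / 2 : ℝ)) • x₂ + (1 - ε ^ 2 * s ^ 2) • x₁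
          + (κ * (ε ^ 2 * s ^ 2 + √(1 - ε ^ 2 * s ^ 2))) • x₃) := by
  rw [← mul_pow]
  set a := ε * s with hadef
  have ha2 : a ^ 2 < 1 := (sq_lt_one_iff_abs_lt_one a).2 ha
  have hI := integral_inv_one_add_mul_cos_sq ha
  have hK := integral_sin_sq_div_one_add_mul_cos_sq ha
  have hpow : (1 - a ^ 2) ^ (3 / 2 : ℝ) = √(1 - a ^ 2) ^ 3 := by
    rw [Real.sqrt_eq_rpow, ← Real.rpow_natCast (_ ^ (1 / 2 : ℝ)) 3, ← Real.rpow_mul (by linarith)]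
    norm_num
  rw [hpow]
  set r := √(1 - a ^ 2) with hr
  have hr0 : 0 < r := Real.sqrt_pos.2 (by linarith)
  have hr2 : r ^ 2 = 1 - a ^ 2 := Real.sq_sqrt (by linarith)
  set D : ℝ → ℝ := fun τ => 1 + a * Real.cos τ with hD
  have hcont : ∀ {p : ℝ → ℝ}, Continuous p → Continuous fun τ => p τ / D τ ^ 2 := fun hp =>
    continuous_div_one_add_mul_cos ha hp 2
  have hodd : ∀ {p : ℝ → ℝ}, (∀ τ, p (2 * π - τ) = -p τ) →
      ∫ τ in (0 : ℝ)..(2 * π), p τ / D τ ^ 2 = 0 := fun {p} hp =>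
    integral_eq_zero_of_antisymm fun τ => by
      simp only [hp, hD, Real.cos_two_pi_sub, neg_div]
  have i₂ : ∫ τ in (0 : ℝ)..(2 * π), (Real.cos τ / s + ε) ^ 2 / D τ ^ 2 =
      (2 * π - r ^ 2 * (2 * π / (r * (1 + r)))) / s ^ 2 := by
    -- From `(cos τ + a)² = (1 + a cos τ)² - (1 - a²) sin² τ`.
    have hpt : ∀ τ, (Real.cos τ / s + ε) ^ 2 / D τ ^ 2 =
        (1 - r ^ 2 * (Real.sin τ ^ 2 / D τ ^ 2)) / s ^ 2 := fun τ => by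
      have hDτ : D τ ≠ 0 := (one_add_mul_cos_pos ha τ).ne'
      have e : Real.cos τ / s + ε = (Real.cos τ + a) / s := by
        rw [hadef]; field_simp
      rw [e, hr2, Real.sin_sq]
      field_simp
      rw [hD]
      ring
    simp only [hpt]
    rw [intervalIntegral.integral_div, intervalIntegral.integral_sub (by simp)
      (((hcont (p := fun τ => Real.sin τ ^ 2) (by fun_prop)).const_mul _).intervalIntegrable _ _),
      intervalIntegral.integral_const_mul, hK]
    simp
  have i₃ : ∫ τ in (0 : ℝ)..(2 * π), (κ * Real.cos τ ^ 2) / D τ ^ 2 =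
      κ * (2 * π / r ^ 3 - 2 * π / (r * (1 + r))) := by
    rw [← hI, ← hK, ← intervalIntegral.integral_sub
      ((hcont (p := fun _ => 1) (by fun_prop)).intervalIntegrable _ _)
      ((hcont (p := fun τ => Real.sin τ ^ 2) (by fun_prop)).intervalIntegrable _ _),
      ← intervalIntegral.integral_const_mul]
    congr 1
    ext τ
    rw [Real.cos_sq']
    ring
  have i₄ : ∫ τ in (0 : ℝ)..(2 * π), Real.sin τ / D τ ^ 2 = 0 :=
    hodd fun τ => Real.sin_two_pi_sub τ
  have i₅ : ∫ τ in (0 : ℝ)..(2 * π), (Real.sin τ * (Real.cos τ / s + ε)) / D τ ^ 2 = 0 :=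
    hodd (p := fun τ => Real.sin τ * (Real.cos τ / s + ε)) fun τ => by
      simp [Real.sin_two_pi_sub, Real.cos_two_pi_sub]
  have hint : ∀ {p : ℝ → ℝ} (x : 𝕜), Continuous p →
      IntervalIntegrable (fun τ => (p τ / D τ ^ 2) • x) volume 0 (2 * π) := fun x hp =>
    ((hcont hp).smul continuous_const).intervalIntegrable _ _
  have hsplit : ∀ τ, (1 / D τ ^ 2) •
      (Real.sin τ ^ 2 • x₁ + (Real.cos τ / s + ε) ^ 2 • x₂ + (κ * Real.cos τ ^ 2) • x₃
        + Real.sin τ • x₄ + (Real.sin τ * (Real.cos τ / s + ε)) • x₅) =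
      (Real.sin τ ^ 2 / D τ ^ 2) • x₁ + ((Real.cos τ / s + ε) ^ 2 / D τ ^ 2) • x₂
        + ((κ * Real.cos τ ^ 2) / D τ ^ 2) • x₃ + (Real.sin τ / D τ ^ 2) • x₄
        + ((Real.sin τ * (Real.cos τ / s + ε)) / D τ ^ 2) • x₅ := by
    intro τ
    simp only [smul_add, smul_smul, one_div_mul_eq_div]
  have h₁ := hint (p := fun τ => Real.sin τ ^ 2) x₁ (by fun_prop)
  have h₂ := hint (p := fun τ => (Real.cos τ / s + ε) ^ 2) x₂ (by fun_prop)
  have h₃ := hint (p := fun τ => κ * Real.cos τ ^ 2) x₃ (by fun_prop)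
  have h₄ := hint (p := fun τ => Real.sin τ) x₄ (by fun_prop)
  have h₅ := hint (p := fun τ => Real.sin τ * (Real.cos τ / s + ε)) x₅ (by fun_prop)
  rw [hI, intervalIntegral.integral_congr fun τ _ => hsplit τ,
    intervalIntegral.integral_add (((h₁.add h₂).add h₃).add h₄) h₅,
    intervalIntegral.integral_add ((h₁.add h₂).add h₃) h₄,
    intervalIntegral.integral_add (h₁.add h₂) h₃, intervalIntegral.integral_add h₁ h₂]
  simp only [intervalIntegral.integral_smul_const]
  rw [hK, i₂, i₃, i₄, i₅]
  simp only [zero_smul, add_zero, smul_add, smul_smul]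
  rw [add_comm ((_ : ℝ) • x₁)]
  have hpi := pi_pos
  congr 1
  · congr 1
    · congr 1
      field_simp
      ring
    · congr 1
      rw [← hr2]
      field_simp
  · congr 1
    rw [show a ^ 2 = 1 - r ^ 2 by linarith]
    field_simp
    ring

end FinslerSurface

/-- The Finsler-Laplace operator of the Katok-Ziller metric `F_ε` on `S²`, in the spherical
coordinates `(φ, θ)`. -/
theorem mainTheorem3 {𝕜 : Type*} [RCLike 𝕜] (ε : ℝ) (hε : |ε| < 1)
    (φ θ : ℝ) (hφ : φ ∈ Ioo 0 π)
    (f : S2 → 𝕜) (hf : ContMDiffAt (𝓡 2) 𝓘(ℝ, 𝕜) 2 f (spherical φ θ))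
    (e : OpenPartialHomeomorph S2 Plane) (he : e ∈ IsManifold.maximalAtlas (𝓡 2) ∞ S2)
    (hp : spherical φ θ ∈ e.source) :
    LaplacianExistsAt e (katokZillerS2 ε) f (spherical φ θ) ∧
    finslerLaplacian e (katokZillerS2 ε) f (spherical φ θ) =
      (2 / (1 + √(1 - ε ^ 2 * Real.sin φ ^ 2)) : ℝ) •
        ((1 / Real.sin φ ^ 2 * (1 - ε ^ 2 * Real.sin φ ^ 2) ^ (3 / 2 : ℝ)) •
            iteratedDeriv 2 (fun θ' : ℝ => f (spherical φ θ')) θ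
          + (1 - ε ^ 2 * Real.sin φ ^ 2) •
            iteratedDeriv 2 (fun φ' : ℝ => f (spherical φ' θ)) φ
          + (Real.cos φ / Real.sin φ *
              (ε ^ 2 * Real.sin φ ^ 2 + √(1 - ε ^ 2 * Real.sin φ ^ 2))) •
            deriv (fun φ' : ℝ => f (spherical φ' θ)) φ) := by
  have hs : 0 < Real.sin φ := Real.sin_pos_of_mem_Ioo hφ
  have ha : |ε * Real.sin φ| < 1 := by
    rw [abs_mul]
    have := Real.abs_sin_le_one φ
    nlinarith [abs_nonneg ε, abs_nonneg (Real.sin φ)]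
  have h := sphereImmersion_chart he
  have hF := isZermeloMetric_chart hε he
  obtain ⟨g, hg, hfg⟩ := exists_extension hf
  obtain ⟨b, hb0, hb1, hb2⟩ := exists_spherical_frame φ θ
  set r : Plane → Space := fun y => (e.symm y : Space) with hrdef
  set x : Plane := e (spherical φ θ) with hx
  have hxt : x ∈ e.target := e.map_source hp
  have hsymm : e.symm x = spherical φ θ := e.left_inv hp
  have hrx : r x = spherical φ θ := by rw [hrdef]; simp only [hsymm]
  have hbx : b 0 = r x := by rw [hb0, hrx]
  have hgx : ContDiffAt ℝ 2 g (r x) := by rwa [hrx]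
  have hfgx : f ∘ e.symm =ᶠ[nhds x] g ∘ r := by
    have hc : ContinuousAt e.symm x := e.continuousAt_symm hxt
    rw [ContinuousAt, hsymm] at hc
    exact hc.eventually hfg
  have hline : ∀ t : ℝ, HasDerivAt (fun t : ℝ => ((x, t) : HPlane)) vert t := fun t =>
    (hasDerivAt_const t x).prodMk (hasDerivAt_id t)
  have hW : ∀ t, HasDerivAt (fun t => relVelocity r ε (x, t))
      (fderiv ℝ (relVelocity r ε) (x, t) vert) t := fun t =>
    (h.differentiableAt_relVelocity hε (z := (x, t)) hxt).hasFDerivAt.comp_hasDerivAt t (hline t)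
  have hWc : Continuous fun t => fderiv ℝ (relVelocity r ε) (x, t) vert := by
    refine continuous_iff_continuousAt.2 fun t => ?_
    have h1 : ContinuousAt (fderiv ℝ (relVelocity r ε)) (x, t) :=
      ((h.contDiffAt_relVelocity hε (z := (x, t)) hxt).fderiv_right (m := 0)
        (by norm_num)).continuousAt
    have h2 : ContinuousAt (fun t : ℝ => fderiv ℝ (relVelocity r ε) (x, t)) t :=
      ContinuousAt.comp (f := fun t : ℝ => ((x, t) : HPlane)) h1 (hline t).continuousAt
    exact h2.clm_apply continuousAt_const
  have hcoord : ∀ i t, HasDerivAt (fun t => inner ℝ (b i) (relVelocity r ε (x, t)))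
      (inner ℝ (b i) (fderiv ℝ (relVelocity r ε) (x, t) vert)) t := fun i t =>
    (innerSL ℝ (b i)).hasFDerivAt.comp_hasDerivAt t (hW t)
  -- `T` is the angle of `W` from east towards south, as a function of the fibre coordinate of the
  -- chart.
  obtain ⟨T, hT⟩ := exists_angle_lift (hcoord 1) (hcoord 2)
    (continuous_const.inner hWc) (continuous_const.inner hWc)
    (fun t => h.frame_relVelocity_sq hε (z := (x, t)) hxt hbx)
  have hper : relVelocity r ε (x, 2 * π) = relVelocity r ε (x, 0) := by
    simp [relVelocity, ray]
  have hWT : ∀ t, relVelocity r ε (x, t) =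
      Real.cos (T t) • sphericalEast θ + Real.sin (T t) • sphericalSouth φ θ := by
    intro t
    have h0 : inner ℝ (b 0) (relVelocity r ε (x, t)) = 0 := by
      rw [hbx]; exact h.inner_relVelocity (z := (x, t)) hxt
    rw [eq_of_inner_frame b h0, (hT t).2.1, (hT t).2.2, hb1, hb2]
  have hWcont : Continuous fun t => relVelocity r ε (x, t) :=
    continuous_iff_continuousAt.2 fun t => (hW t).continuousAt
  have hfactor : ∀ t, hilbertFactor r ε (x, t) = 1 + ε * Real.sin φ * Real.cos (T t) := by
    intro t
    rw [hilbertFactor]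
    simp only [hrx, rotGen_spherical]
    rw [inner_smul_right, inner_smul_right, real_inner_comm, ← hb1, (hT t).2.1]
    ring
  have hnear : ∀ {γ : ℝ → S2} {t : ℝ}, ContinuousAt (fun s => (γ s : Space)) t →
      γ t = spherical φ θ →
      (fun s => f (γ s)) =ᶠ[nhds t] g ∘ fun s => (γ s : Space) := by
    intro γ t hγ ht
    have hγ' : ContinuousAt γ t := Topology.IsInducing.subtypeVal.continuousAt_iff.2 hγ
    rw [ContinuousAt, ht] at hγ'
    exact hγ'.eventually hfg
  have dφ := hnear (hasDerivAt_spherical_colatitude φ θ).continuousAt rfl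
  have dθ := hnear (hasDerivAt_spherical_longitude φ θ).continuousAt rfl
  have gφ := (deriv_eventuallyEq_of_curve hg
    (fun t => hasDerivAt_spherical_colatitude t θ) dφ).eq_of_nhds
  have gφφ := iteratedDeriv_two_of_curve hg (fun t => hasDerivAt_spherical_colatitude t θ)
    (hasDerivAt_sphericalSouth φ θ) dφ
  have gθθ := iteratedDeriv_two_of_curve hg (fun t => hasDerivAt_spherical_longitude φ t)
    (hasDerivAt_sphericalEast φ θ) dθ
  set fφ := deriv (fun φ' : ℝ => f (spherical φ' θ)) φ
  set fφφ := iteratedDeriv 2 (fun φ' : ℝ => f (spherical φ' θ)) φ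
  set fθθ := iteratedDeriv 2 (fun θ' : ℝ => f (spherical φ θ')) θ
  set D₁ := fderiv ℝ g (spherical φ θ : Space)
  set D₂ := fderiv ℝ (fderiv ℝ g) (spherical φ θ : Space)
  set x₄ : 𝕜 := (2 * ε * Real.cos φ) • D₁ (sphericalEast θ)
  set x₅ : 𝕜 := D₂ (sphericalSouth φ θ) (Real.sin φ • sphericalEast θ) +
    D₂ (Real.sin φ • sphericalEast θ) (sphericalSouth φ θ)
  set G : ℝ → 𝕜 := fun τ => Real.sin τ ^ 2 • fφφ + (Real.cos τ / Real.sin φ + ε) ^ 2 • fθθ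
    + (Real.cos φ / Real.sin φ * Real.cos τ ^ 2) • fφ + Real.sin τ • x₄
    + (Real.sin τ * (Real.cos τ / Real.sin φ + ε)) • x₅ with hG
  have hLL : ∀ t, lieDeriv (localMetric e (katokZillerS2 ε)) (lieDeriv
      (localMetric e (katokZillerS2 ε)) (fun z : HPlane => (f ∘ e.symm) z.1)) (x, t) = G (T t) := by
    intro t
    rw [h.lieDeriv_lieDeriv hε hF (z := (x, t)) hxt hgx hfgx]
    simp only [hrx, hWT t]
    rw [geodesic_acceleration ε θ (T t) hs.ne']
    -- The velocity in spherical coordinates: `φ' = sin τ` and `θ' = cos τ / sin φ + ε`, with `τ = T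
    -- t`.
    have hu : Real.cos (T t) • sphericalEast θ + Real.sin (T t) • sphericalSouth φ θ +
        ε • rotGen (spherical φ θ) = Real.sin (T t) • sphericalSouth φ θ +
          (Real.cos (T t) / Real.sin φ + ε) • (Real.sin φ • sphericalEast θ) := by
      rw [rotGen_spherical]
      match_scalars <;> field_simp
    rw [hu, hG]
    simp only [gφ, gφφ, gθθ, x₄, x₅, map_add, map_smul, add_apply, smul_apply, D₁, D₂]
    module
  have key := planeLaplacian_eq_circle_average (F := localMetric e (katokZillerS2 ε))
    (f := f ∘ e.symm) (x := x) (T := T) (w := fun t => SphereImmersion.angularSpeed r ε b (x, t))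
    (m := fun τ => 1 / (1 + ε * Real.sin φ * Real.cos τ) ^ 2) (G := G)
    (C := SphereImmersion.frameJacobian r b x)
    (fun t => (hT t).1)
    (by
      unfold SphereImmersion.angularSpeed
      fun_prop)
    (fun t => h.angularSpeed_ne_zero hε (z := (x, t)) hxt hbx)
    (by rw [← (hT _).2.1, ← (hT _).2.1, hper])
    (by rw [← (hT _).2.2, ← (hT _).2.2, hper])
    (continuous_div_one_add_mul_cos ha continuous_const 2)
    (fun τ => by simp only [Real.cos_add_two_pi])
    (by fun_prop)
    (fun τ => by simp only [hG, Real.cos_add_two_pi, Real.sin_add_two_pi])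
    (h.frameJacobian_ne_zero hxt hbx)
    (fun t => by
      rw [h.liouvilleDensity_eq_frame hε hF (z := (x, t)) hxt hbx, hfactor t]
      ring)
    hLL
  refine ⟨key.1, key.2.trans ?_⟩
  exact circle_average hs.ne' ha fφφ fθθ fφ x₄ x₅
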